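/- Let $H$ be a separable Hilbert space with its Borel $\sigma$-field, and let $\|\cdot\|_H$ be its norm or, more generally, any Borel measurable norm on $H$. Let $\{X_t\}_{t\in\mathbb Z}$ be a sequence of independent, identically distributed $H$-valued random elements on a probability space, with common law $\mu$. Let $m\ge 1$ be an integer and $\varepsilon>0$. Write $X^m_t=(X_t,X_{t+1},\dots,X_{t+m-1})\in H^m$ for the $m$-histories, $\|x\|_{m,H}=\max_{1\le k\le m}\|x_k\|_H$ for the max-norm on $H^m$, and $I_\varepsilon$ for the indicator function of $[0,\varepsilon)$. Define the functional correlation integral $$C_{m,n}(\varepsilon)=\binom n2^{-1}\sum_{1\le s<t\le n}I_\varepsilon\big(\|X^m_s-X^m_t\|_{m,H}\big),\qquad n\ge 2,$$ and the constants $$C=C(\varepsilon)=\int_H\int_H I_\varepsilon(\|x-y\|_H)\,\mu(dx)\,\mu(dy),\qquad K=K(\varepsilon)=\int_H\Big(\int_H I_\varepsilon(\|x-y\|_H)\,\mu(dx)\Big)^2\mu(dy),$$ $$\sigma_m^2=\sigma_m^2(\varepsilon)=4K^m-4C^{2m}+8\sum_{i=1}^{m-1}\big(K^{m-i}C^{2i}-C^{2m}\big).$$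 Assume the non-degeneracy condition $K(\varepsilon)>C(\varepsilon)^2$. Then: 1. $h(x,y)=I_\varepsilon(\|x-y\|_{m,H})$ is a measurable symmetric kernel on $H^m\times H^m$, and $C_{m,n}(\varepsilon)$ is the generalized U-statistic of order 2 with kernel $h$ of the sequence of $m$-histories, i.e. $C_{m,n}(\varepsilon)=\binom n2^{-1}\sum_{1\le s<t\le n}h(X^m_s,X^m_t)$. 2. $\sigma_m^2(\varepsilon)>0$ and, as $n\to\infty$, $$\sqrt n\;\frac{C_{m,n}(\varepsilon)-C(\varepsilon)^m}{\sigma_m(\varepsilon)}\longrightarrow N(0,1)\quad\text{in distribution}.$$ 3. The convergence in 2 also holds if the sum in the definition of $C_{m,n}(\varepsilon)$ is taken over $1\le s\le t\le n$ (diagonal included), with the same factor $\binom n2^{-1}$. -/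

import Mathlib

open MeasureTheory ProbabilityTheory Filter

noncomputable section

namespace FunctionalBDS

/-- The characteristic function `I_ε` of the interval `[0, ε)`. -/
def indic (ε : ℝ) (r : ℝ) : ℝ := (Set.Ico (0 : ℝ) ε).indicator (fun _ => (1 : ℝ)) r

/-- The max-norm `max_{k = 1, …, m} N (x_k)` on `H^m` built from a norm `N` on `H`
(used for `1 ≤ m`, where the supremum over the finite index set is a maximum). -/
def maxNorm {H : Type*} (N : H → ℝ) {m : ℕ} (x : Fin m → H) : ℝ := ⨆ k : Fin m, N (x k)

/-- The `m`-history `X^m_t = (X_t, X_{t+1}, …, X_{t+m-1})`. -/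
def history {Ω H : Type*} (X : ℤ → Ω → H) (m : ℕ) (t : ℤ) (ω : Ω) : Fin m → H :=
  fun k => X (t + ((k : ℕ) : ℤ)) ω

/-- The function `h(x, y) = I_ε(‖x - y‖_{m, H})` on `H^m × H^m`. -/
def corrKernel {H : Type*} [AddGroup H] (N : H → ℝ) (m : ℕ) (ε : ℝ) (x y : Fin m → H) : ℝ :=
  indic ε (maxNorm N (x - y))

/-- A kernel of order 2: a (jointly) measurable function of two arguments that is symmetric. -/
structure IsKernelTwo {E : Type*} [MeasurableSpace E] (h : E → E → ℝ) : Prop where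
  measurable : Measurable (fun p : E × E => h p.1 p.2)
  symm : ∀ x y, h x y = h y x

/-- The generalized U-statistic of order 2 of the (possibly dependent) sequence `Y`
with kernel `h`: `(n choose 2)⁻¹ ∑_{1 ≤ s < t ≤ n} h(Y_s, Y_t)`. -/
def uStatTwo {Ω E : Type*} (h : E → E → ℝ) (Y : ℤ → Ω → E) (n : ℕ) (ω : Ω) : ℝ :=
  ((n.choose 2 : ℕ) : ℝ)⁻¹ *
    ∑ s ∈ Finset.Icc (1 : ℤ) n, ∑ t ∈ Finset.Ioc s (n : ℤ), h (Y s ω) (Y t ω)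

/-- The functional correlation integral at embedding dimension `m`, summed over the pairs
`1 ≤ s < t ≤ n`. -/
def corrIntegral {Ω H : Type*} [AddGroup H] (N : H → ℝ) (X : ℤ → Ω → H) (m n : ℕ) (ε : ℝ)
    (ω : Ω) : ℝ :=
  ((n.choose 2 : ℕ) : ℝ)⁻¹ *
    ∑ s ∈ Finset.Icc (1 : ℤ) n, ∑ t ∈ Finset.Ioc s (n : ℤ),
      indic ε (maxNorm N (history X m s ω - history X m t ω))

/-- The variant of the functional correlation integral whose sum includes the diagonal, that is,
runs over the pairs `1 ≤ s ≤ t ≤ n` (with the same normalisation). -/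
def corrIntegralDiag {Ω H : Type*} [AddGroup H] (N : H → ℝ) (X : ℤ → Ω → H) (m n : ℕ) (ε : ℝ)
    (ω : Ω) : ℝ :=
  ((n.choose 2 : ℕ) : ℝ)⁻¹ *
    ∑ s ∈ Finset.Icc (1 : ℤ) n, ∑ t ∈ Finset.Icc s (n : ℤ),
      indic ε (maxNorm N (history X m s ω - history X m t ω))

/-- `C(ε) = ∫ ∫ I_ε(‖x - y‖) μ(dx) μ(dy)`. -/
def corrC {H : Type*} [AddGroup H] [MeasurableSpace H] (N : H → ℝ) (μ : Measure H) (ε : ℝ) : ℝ :=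
  ∫ y, ∫ x, indic ε (N (x - y)) ∂μ ∂μ

/-- `K(ε) = ∫ (∫ I_ε(‖x - y‖) μ(dx))² μ(dy)`. -/
def corrK {H : Type*} [AddGroup H] [MeasurableSpace H] (N : H → ℝ) (μ : Measure H) (ε : ℝ) : ℝ :=
  ∫ y, (∫ x, indic ε (N (x - y)) ∂μ) ^ 2 ∂μ

/-- `σ_m² = 4 K^m - 4 C^{2m} + 8 ∑_{i=1}^{m-1} (K^{m-i} C^{2i} - C^{2m})`. -/
def sigmaSq (K C : ℝ) (m : ℕ) : ℝ :=
  4 * K ^ m - 4 * C ^ (2 * m)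
    + 8 * ∑ i ∈ Finset.Ico 1 m, (K ^ (m - i) * C ^ (2 * i) - C ^ (2 * m))

end FunctionalBDS

end

open scoped Topology NNReal

/-! A maximum is below `ε` exactly when every entry is, so the kernel factorises: `h(x, y) = ∏ I_ε(N
(x_k - y_k))` (`indic_maxNorm`). Integrating out one argument gives the product of the ball masses
`g(y_k)`, where `g = ballMass`. The variables `g(X_j)` are i.i.d. and bounded, with mean `C` and
second moment `K`. The Hoeffding decomposition (`corrIntegral_sub_eq`) writes `C_{m,n} - C^m` as a
linear part, `2/n` times a sum of centred products of `m` consecutive `g(X_j)`, plus a completely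
degenerate part.

The linear part yields the limit. Windows at lag `i < m` share `m - i` factors, so their covariance
is `K^(m-i) C^(2i) - C^(2m)`; the resulting long-run variance, times `2²`, is `σ_m²`. The central
limit theorem (`tendstoInDistribution_sum_windowProd`) uses Bernstein blocks: dropping the last `m`
windows of each block of length `p + m` leaves i.i.d. block sums, and the dropped part is small in
mean square as `p → ∞`, uniformly for large `n`.

The degenerate part is negligible. In the second moment of its sum, a term vanishes as soon as one
of its four times is at distance at least `m` from the other three; only `O(n²)` quadruples survive
(`integral_sum_degenerate_sq_le`). After normalisation the second moment is `O(1/n)`, and Slutsky's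
lemma concludes. The diagonal contributes a deterministic term of order `n^(-1/2)`. -/

namespace FunctionalBDS

/-! ### Tools: independence of rows, Gaussian limits through mean-square approximation -/

/-- The rows of an independent array are independent. -/
theorem iIndepFun_curry {Ω ι κ 𝓧 : Type*} [MeasurableSpace Ω] {P : Measure Ω}
    [MeasurableSpace 𝓧] {X : ι × κ → Ω → 𝓧} (mX : ∀ p, Measurable (X p)) (h : iIndepFun X P) :
    iIndepFun (fun (i : ι) ω (j : κ) => X (i, j) ω) P := by
  have := h.isProbabilityMeasure
  have hp : ∀ p, IsProbabilityMeasure (P.map (X p)) :=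
    fun p ↦ Measure.isProbabilityMeasure_map (mX p).aemeasurable
  have h' : iIndepFun (fun (p : (_ : ι) × κ) ω => X (p.1, p.2) ω) P :=
    h.precomp (Equiv.sigmaEquivProd ι κ).injective
  have hrow : ∀ i, iIndepFun (fun (j : κ) ω => X (i, j) ω) P := fun i =>
    h.precomp (g := fun j : κ => (i, j)) (fun a b hab => by simpa using hab)
  rw [iIndepFun_iff_map_fun_eq_infinitePi_map (fun p => mX _)] at h'
  rw [iIndepFun_iff_map_fun_eq_infinitePi_map (by fun_prop)]
  -- Independence means that the joint law is a product measure; currying turns a product over pairs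
  -- into a product of products.
  have key := congrArg (Measure.map (MeasurableEquiv.piCurry (fun (_ : ι) (_ : κ) => 𝓧))) h'
  rw [Measure.map_map (by fun_prop) (by fun_prop),
    Measure.infinitePi_map_piCurry (fun i j => P.map (X (i, j)))] at key
  refine key.trans ?_
  congr 1
  funext i
  exact ((iIndepFun_iff_map_fun_eq_infinitePi_map (fun j => mX _)).1 (hrow i)).symm

/-- Convergence in distribution only depends on the law of the limit. -/
theorem TendstoInDistribution.id_of_map_eq {Ω Ω' : Type*} [MeasurableSpace Ω]
    [MeasurableSpace Ω'] {P : Measure Ω} [IsProbabilityMeasure P] {P' : Measure Ω'}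
    [IsProbabilityMeasure P'] {T : ℕ → Ω → ℝ} {Z : Ω' → ℝ} {ν : Measure ℝ}
    [IsProbabilityMeasure ν] (h : TendstoInDistribution T atTop Z (fun _ => P) P')
    (hZ : P'.map Z = ν) : TendstoInDistribution T atTop id (fun _ => P) ν where
  forall_aemeasurable := h.forall_aemeasurable
  tendsto := by
    have e : (⟨P'.map Z, Measure.isProbabilityMeasure_map h.aemeasurable_limit⟩ :
        ProbabilityMeasure ℝ)
        = ⟨ν.map id, Measure.isProbabilityMeasure_map aemeasurable_id⟩ :=
      Subtype.ext (hZ.trans Measure.map_id.symm)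
    exact e ▸ h.tendsto

theorem integral_abs_le_sqrt {Ω : Type*} [MeasurableSpace Ω] {P : Measure Ω}
    [IsProbabilityMeasure P] {D : Ω → ℝ} (hD : MemLp D 2 P) :
    ∫ ω, |D ω| ∂P ≤ √(∫ ω, D ω ^ 2 ∂P) := by
  have h := variance_nonneg (fun ω => |D ω|) P
  rw [variance_eq_sub (by simpa using hD.norm)] at h
  apply Real.le_sqrt_of_sq_le
  simp only [Pi.pow_apply, sq_abs] at h
  linarith

/-- Follows from `|e^{ia} - e^{ib}| ≤ |a - b|` and `E|D| ≤ √(E D²)`. -/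
theorem norm_charFun_sub_le {Ω : Type*} [MeasurableSpace Ω] {P : Measure Ω}
    [IsProbabilityMeasure P] {T S : Ω → ℝ} (hT : AEMeasurable T P) (hS : AEMeasurable S P)
    (hD : MemLp (fun ω => T ω - S ω) 2 P) (t : ℝ) :
    ‖charFun (P.map T) t - charFun (P.map S) t‖ ≤ |t| * √(∫ ω, (T ω - S ω) ^ 2 ∂P) := by
  have hint : ∀ {Z : Ω → ℝ}, AEMeasurable Z P →
      Integrable (fun ω => Complex.exp (t * Z ω * Complex.I)) P := fun {Z} hZ => by
    refine Integrable.of_bound (C := 1) (by fun_prop) (ae_of_all _ fun ω => ?_)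
    rw [← Complex.ofReal_mul, Complex.norm_exp_ofReal_mul_I]
  rw [charFun_apply_real, charFun_apply_real, integral_map hT (by fun_prop),
    integral_map hS (by fun_prop), ← integral_sub (hint hT) (hint hS)]
  calc _ ≤ ∫ ω, |t| * |T ω - S ω| ∂P := by
        refine norm_integral_le_of_norm_le ((hD.integrable (by norm_num)).abs.const_mul _)
          (ae_of_all _ fun ω => ?_)
        have : Complex.exp (t * T ω * Complex.I) - Complex.exp (t * S ω * Complex.I)
            = Complex.exp ((t * S ω : ℝ) * Complex.I) *
              (Complex.exp (Complex.I * (t * (T ω - S ω) : ℝ)) - 1) := by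
          rw [mul_sub, ← Complex.exp_add, mul_one]
          push_cast
          ring_nf
        rw [this, norm_mul, Complex.norm_exp_ofReal_mul_I, one_mul, ← abs_mul]
        exact Real.norm_exp_I_mul_ofReal_sub_one_le
    _ = |t| * ∫ ω, |T ω - S ω| ∂P := integral_const_mul _ _
    _ ≤ _ := by gcongr; exact integral_abs_le_sqrt hD

/-- A sequence which is approximated in mean square, uniformly for large times, by sequences
converging in distribution to centred Gaussians converges in distribution. -/
theorem tendstoInDistribution_gaussian_of_approx {Ω : Type*} [MeasurableSpace Ω] {P : Measure Ω}
    [IsProbabilityMeasure P] {T : ℕ → Ω → ℝ} {S : ℕ → ℕ → Ω → ℝ} {v : ℕ → ℝ≥0} {w : ℝ≥0}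
    {a : ℕ → ℝ} (hT : ∀ n, AEMeasurable (T n) P)
    (hS : ∀ p, TendstoInDistribution (S p) atTop id (fun _ => P) (gaussianReal 0 (v p)))
    (hv : Tendsto v atTop (𝓝 w)) (hL2 : ∀ p n, MemLp (fun ω => T n ω - S p n ω) 2 P)
    (hbound : ∀ p, ∀ᶠ n in atTop, ∫ ω, (T n ω - S p n ω) ^ 2 ∂P ≤ a p)
    (ha : Tendsto a atTop (𝓝 0)) :
    TendstoInDistribution T atTop id (fun _ => P) (gaussianReal 0 w) where
  forall_aemeasurable := hT
  tendsto := by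
    refine ProbabilityMeasure.tendsto_iff_tendsto_charFun.2 fun t => ?_
    have hS' := fun p => ProbabilityMeasure.tendsto_iff_tendsto_charFun.1 (hS p).tendsto t
    simp only [ProbabilityMeasure.coe_mk, Measure.map_id] at hS' ⊢
    have hφ : Tendsto (fun p => charFun (gaussianReal 0 (v p)) t) atTop
        (𝓝 (charFun (gaussianReal 0 w) t)) := by
      simp only [charFun_gaussianReal]
      have : Tendsto (fun p => ((v p : ℝ) : ℂ)) atTop (𝓝 ((w : ℝ) : ℂ)) :=
        (Complex.continuous_ofReal.tendsto _).comp ((NNReal.continuous_coe.tendsto _).comp hv)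
      refine (Complex.continuous_exp.tendsto _).comp ?_
      exact tendsto_const_nhds.sub ((this.mul_const _).div_const _)
    have ha' : Tendsto (fun p => |t| * √(a p)) atTop (𝓝 0) := by
      simpa using (ha.sqrt).const_mul |t|
    rw [Metric.tendsto_atTop]
    intro ε hε
    -- `p` is fixed before `n`, so the threshold in `hbound` may depend on `p`.
    obtain ⟨p, hp1, hp2⟩ := (((Metric.tendsto_nhds.1 hφ (ε / 3) (by positivity))).and
      (ha'.eventually_lt_const (show (0 : ℝ) < ε / 3 by positivity))).exists
    obtain ⟨n₀, hn₀⟩ := eventually_atTop.1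
      ((Metric.tendsto_nhds.1 (hS' p) (ε / 3) (by positivity)).and (hbound p))
    refine ⟨n₀, fun n hn => ?_⟩
    obtain ⟨h1, h2⟩ := hn₀ n hn
    have h3 := norm_charFun_sub_le (hT n) ((hS p).forall_aemeasurable n) (hL2 p n) t
    have h4 : |t| * √(∫ ω, (T n ω - S p n ω) ^ 2 ∂P) ≤ |t| * √(a p) := by gcongr
    rw [← dist_eq_norm] at h3
    have h5 := dist_triangle4 (charFun (P.map (T n)) t) (charFun (P.map (S p n)) t)
      (charFun (gaussianReal 0 (v p)) t) (charFun (gaussianReal 0 w) t)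
    linarith

/-- Convergence to zero in mean square implies convergence in measure. -/
theorem tendstoInMeasure_zero_of_integral_sq {Ω : Type*} [MeasurableSpace Ω] {P : Measure Ω}
    [IsProbabilityMeasure P] {D : ℕ → Ω → ℝ} (hD : ∀ n, MemLp (D n) 2 P)
    (h : Tendsto (fun n => ∫ ω, D n ω ^ 2 ∂P) atTop (𝓝 0)) :
    TendstoInMeasure P D atTop 0 := by
  refine tendstoInMeasure_of_tendsto_eLpNorm (p := 2) (by norm_num)
    (fun n => (hD n).aestronglyMeasurable) aestronglyMeasurable_const ?_
  have : ∀ n, eLpNorm (D n - 0) 2 P = ENNReal.ofReal √(∫ ω, D n ω ^ 2 ∂P) := fun n => by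
    rw [sub_zero, (hD n).eLpNorm_eq_integral_rpow_norm (by norm_num) (by norm_num)]
    congr 1
    rw [Real.sqrt_eq_rpow]
    norm_num
  simp_rw [this]
  simpa [Function.comp_def] using (ENNReal.continuous_ofReal.tendsto _).comp h.sqrt

/-! ### Covariances and long-run variance of window products -/

/-- The covariance at lag `i` of products of `m` consecutive terms of an i.i.d. sequence with
mean `C` and second moment `K`. -/
noncomputable def windowCov (K C : ℝ) (m i : ℕ) : ℝ :=
  -- For `i ≥ m` the truncated `m - i` is `0` and `min i m = m`, so disjoint windows get covariance
  -- `0`.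
  K ^ (m - i) * C ^ (2 * min i m) - C ^ (2 * m)

theorem windowCov_of_le {K C : ℝ} {m i : ℕ} (h : m ≤ i) : windowCov K C m i = 0 := by
  simp [windowCov, h]

/-- The centred product of `m` consecutive terms of `G`, starting at `t`. -/
noncomputable def windowProd {Ω : Type*} (G : ℕ → Ω → ℝ) (C : ℝ) (m t : ℕ) (ω : Ω) : ℝ :=
  ∏ j ∈ Finset.Ico t (t + m), G j ω - C ^ m

/-- A bounded i.i.d. sequence of real random variables with mean `C` and second moment `K`. -/
structure IsBoundedIID {Ω : Type*} [MeasurableSpace Ω] (P : Measure Ω) (G : ℕ → Ω → ℝ)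
    (C K : ℝ) : Prop where
  measurable : ∀ j, Measurable (G j)
  abs_le_one : ∀ j ω, |G j ω| ≤ 1
  indep : iIndepFun G P
  ident : ∀ j, IdentDistrib (G j) (G 0) P P
  mean : ∫ ω, G 0 ω ∂P = C
  second : ∫ ω, G 0 ω ^ 2 ∂P = K

section

variable {Ω : Type*} [MeasurableSpace Ω] {P : Measure Ω}
  {G : ℕ → Ω → ℝ} {C K : ℝ}

namespace IsBoundedIID

theorem mean_eq (h : IsBoundedIID P G C K) (j : ℕ) : ∫ ω, G j ω ∂P = C :=
  (h.ident j).integral_eq.trans h.mean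

theorem second_eq (h : IsBoundedIID P G C K) (j : ℕ) : ∫ ω, G j ω ^ 2 ∂P = K :=
  ((h.ident j).comp (u := fun x : ℝ => x ^ 2) (by fun_prop)).integral_eq.trans h.second

theorem measurable_windowProd (h : IsBoundedIID P G C K) (m t : ℕ) :
    Measurable (windowProd G C m t) :=
  (Finset.measurable_fun_prod _ fun j _ => h.measurable j).sub_const _

theorem abs_prod_le (h : IsBoundedIID P G C K) (A : Finset ℕ) (ω : Ω) :
    |∏ j ∈ A, G j ω| ≤ 1 := by
  rw [Finset.abs_prod]
  exact Finset.prod_le_one (fun _ _ => abs_nonneg _) fun j _ => h.abs_le_one j ω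

/-- By independence, an index in both sets contributes `E G² = K`, and an index in exactly one
contributes `E G = C`. -/
theorem integral_prod_mul_prod (h : IsBoundedIID P G C K) (A B : Finset ℕ) :
    ∫ ω, (∏ j ∈ A, G j ω) * ∏ j ∈ B, G j ω ∂P
      = K ^ (A ∩ B).card * C ^ ((A \ B).card + (B \ A).card) := by
  let f : ℕ → ℝ → ℝ := fun j x => (if j ∈ A then x else 1) * (if j ∈ B then x else 1)
  have hf : ∀ j, Measurable (f j) := fun j => by
    simp only [f]; split_ifs <;> fun_prop
  have h1 : ∀ ω, (∏ j ∈ A, G j ω) * ∏ j ∈ B, G j ω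
      = ∏ j : ↥(A ∪ B), f j (G j ω) := fun ω => by
    rw [Finset.prod_coe_sort (A ∪ B) (fun j => f j (G j ω)), Finset.prod_mul_distrib,
      Finset.prod_ite_mem, Finset.prod_ite_mem, Finset.union_inter_cancel_left,
      Finset.union_inter_cancel_right]
  simp_rw [h1]
  rw [iIndepFun.integral_fun_prod_comp (X := fun j : ↥(A ∪ B) => G j)
    (h.indep.precomp Subtype.val_injective) (fun j => (h.measurable _).aemeasurable)
    (fun j => (hf j).aestronglyMeasurable),
    Finset.prod_coe_sort (A ∪ B) (fun j => ∫ ω, f j (G j ω) ∂P)]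
  have hd : A ∪ B = (A ∩ B) ∪ ((A \ B) ∪ (B \ A)) := by
    ext j; simp only [Finset.mem_union, Finset.mem_inter, Finset.mem_sdiff]; tauto
  rw [hd, Finset.prod_union, Finset.prod_union, pow_add]
  · congr 1
    · refine Finset.prod_eq_pow_card fun j hj => ?_
      rw [Finset.mem_inter] at hj
      simp [f, hj.1, hj.2, ← sq, h.second_eq]
    congr 1
    · refine Finset.prod_eq_pow_card fun j hj => ?_
      rw [Finset.mem_sdiff] at hj
      simp [f, hj.1, hj.2, h.mean_eq]
    · refine Finset.prod_eq_pow_card fun j hj => ?_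
      rw [Finset.mem_sdiff] at hj
      simp [f, hj.1, hj.2, h.mean_eq]
  · rw [Finset.disjoint_left]; intro j; simp only [Finset.mem_sdiff]; tauto
  · rw [Finset.disjoint_left]; intro j
    simp only [Finset.mem_union, Finset.mem_inter, Finset.mem_sdiff]; tauto

theorem integral_prod (h : IsBoundedIID P G C K) (A : Finset ℕ) :
    ∫ ω, ∏ j ∈ A, G j ω ∂P = C ^ A.card := by
  simpa using h.integral_prod_mul_prod A ∅

variable [IsProbabilityMeasure P]

theorem abs_mean_le (h : IsBoundedIID P G C K) : |C| ≤ 1 := by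
  rw [← h.mean]
  simpa using norm_integral_le_of_norm_le_const (μ := P) (f := G 0) (C := 1)
    (ae_of_all _ fun ω => h.abs_le_one 0 ω)

theorem abs_windowProd_le (h : IsBoundedIID P G C K) (m t : ℕ) (ω : Ω) :
    |windowProd G C m t ω| ≤ 2 := by
  have h1 := h.abs_prod_le (Finset.Ico t (t + m)) ω
  have h2 : |C ^ m| ≤ 1 := by rw [abs_pow]; exact pow_le_one₀ (abs_nonneg _) h.abs_mean_le
  have := abs_sub (∏ j ∈ Finset.Ico t (t + m), G j ω) (C ^ m)
  rw [windowProd]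
  linarith

theorem memLp_windowProd (h : IsBoundedIID P G C K) (m t : ℕ) :
    MemLp (windowProd G C m t) 2 P :=
  MemLp.of_bound (h.measurable_windowProd m t).aestronglyMeasurable 2
    (ae_of_all _ fun ω => h.abs_windowProd_le m t ω)

theorem integrable_prod (h : IsBoundedIID P G C K) (A : Finset ℕ) :
    Integrable (fun ω => ∏ j ∈ A, G j ω) P :=
  Integrable.of_bound (Finset.measurable_fun_prod _ fun j _ => h.measurable j).aestronglyMeasurable
    1 (ae_of_all _ fun ω => h.abs_prod_le A ω)

theorem integral_windowProd (h : IsBoundedIID P G C K) (m t : ℕ) :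
    ∫ ω, windowProd G C m t ω ∂P = 0 := by
  simp only [windowProd]
  rw [integral_sub (h.integrable_prod _) (integrable_const _), h.integral_prod]
  simp

/-- The two windows share `m - i` indices, and their symmetric difference has `2 * min i m`. -/
theorem integral_windowProd_mul_of_le (h : IsBoundedIID P G C K) (m s i : ℕ) :
    ∫ ω, windowProd G C m s ω * windowProd G C m (s + i) ω ∂P = windowCov K C m i := by
  set A := Finset.Ico s (s + m)
  set B := Finset.Ico (s + i) (s + i + m)
  have h1 : ∀ ω, windowProd G C m s ω * windowProd G C m (s + i) ω
      = (∏ j ∈ A, G j ω) * (∏ j ∈ B, G j ω) - C ^ m * ∏ j ∈ A, G j ω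
        - C ^ m * windowProd G C m (s + i) ω := fun ω => by
    simp only [windowProd]; ring
  have hAB : Integrable (fun ω => (∏ j ∈ A, G j ω) * (∏ j ∈ B, G j ω)) P :=
    (h.integrable_prod B).bdd_mul (c := 1) (h.integrable_prod A).aestronglyMeasurable
      (ae_of_all _ fun ω => h.abs_prod_le A ω)
  have hA2 : Integrable (fun ω => (∏ j ∈ A, G j ω) * (∏ j ∈ B, G j ω)
      - C ^ m * ∏ j ∈ A, G j ω) P := hAB.sub ((h.integrable_prod A).const_mul _)
  simp_rw [h1]
  rw [integral_sub hA2
    (((h.memLp_windowProd m _).integrable (by norm_num)).const_mul _),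
    integral_sub hAB ((h.integrable_prod A).const_mul _), integral_const_mul, integral_const_mul,
    h.integral_prod, h.integral_windowProd, h.integral_prod_mul_prod]
  have c1 : (A ∩ B).card = m - i := by
    simp only [A, B, Finset.Ico_inter_Ico, Nat.card_Ico]; omega
  have cA : A.card = m := by simp [A]
  have cB : B.card = m := by simp [B]
  have c2 := Finset.card_sdiff_add_card_inter A B
  have c3 := Finset.card_sdiff_add_card_inter B A
  rw [Finset.inter_comm B A] at c3
  have c4 : (A \ B).card + (B \ A).card = 2 * min i m := by omega
  rw [c1, c4, cA, windowCov, two_mul m, pow_add]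
  ring

theorem integral_windowProd_mul (h : IsBoundedIID P G C K) (m s t : ℕ) :
    ∫ ω, windowProd G C m s ω * windowProd G C m t ω ∂P = windowCov K C m (Nat.dist s t) := by
  rcases le_total s t with hst | hst
  · obtain ⟨i, rfl⟩ := Nat.exists_eq_add_of_le hst
    rw [h.integral_windowProd_mul_of_le, Nat.dist_eq_sub_of_le hst]
    simp
  · obtain ⟨i, rfl⟩ := Nat.exists_eq_add_of_le hst
    simp_rw [mul_comm (windowProd G C m (t + i) _)]
    rw [h.integral_windowProd_mul_of_le, Nat.dist_eq_sub_of_le_right hst]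
    simp

theorem integral_sum_sq (h : IsBoundedIID P G C K) (m : ℕ) (A : Finset ℕ) :
    ∫ ω, (∑ t ∈ A, windowProd G C m t ω) ^ 2 ∂P
      = ∑ s ∈ A, ∑ t ∈ A, windowCov K C m (Nat.dist s t) := by
  have hi : ∀ s t, Integrable (fun ω => windowProd G C m s ω * windowProd G C m t ω) P :=
    fun s t => (h.memLp_windowProd m s).integrable_mul (h.memLp_windowProd m t)
  simp_rw [sq, Finset.sum_mul_sum]
  rw [integral_finsetSum _ fun s _ => integrable_finsetSum _ fun t _ => hi s t]
  refine Finset.sum_congr rfl fun s _ => ?_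
  rw [integral_finsetSum _ fun t _ => hi s t]
  exact Finset.sum_congr rfl fun t _ => h.integral_windowProd_mul m s t

theorem windowCov_le (h : IsBoundedIID P G C K) (m i : ℕ) : windowCov K C m i ≤ 4 := by
  rw [← h.integral_windowProd_mul_of_le m 0 i]
  refine (le_abs_self _).trans ?_
  have hb : ∀ ω, ‖windowProd G C m 0 ω * windowProd G C m (0 + i) ω‖ ≤ 4 := fun ω => ?_
  · simpa using norm_integral_le_of_norm_le_const (μ := P) (ae_of_all _ hb)
  rw [norm_mul]
  have h1 := h.abs_windowProd_le m 0 ω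
  have h2 := h.abs_windowProd_le m (0 + i) ω
  simp only [Real.norm_eq_abs]
  calc _ ≤ (2 : ℝ) * 2 := by gcongr
    _ = 4 := by norm_num

/-- For fixed `s` fewer than `2 * m` times have lag below `m`, each with covariance at most `4`. The
set `A` is arbitrary because the bound is applied to the times left over by the blocks. -/
theorem integral_sum_sq_le (h : IsBoundedIID P G C K) (m : ℕ) (A : Finset ℕ) :
    ∫ ω, (∑ t ∈ A, windowProd G C m t ω) ^ 2 ∂P ≤ A.card * (8 * m) := by
  rw [h.integral_sum_sq, ← nsmul_eq_mul]
  refine Finset.sum_le_card_nsmul _ _ _ fun s _ => ?_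
  calc ∑ t ∈ A, windowCov K C m (Nat.dist s t)
      ≤ ∑ t ∈ A, (if t ∈ Finset.Ico (s + 1 - m) (s + m) then (4 : ℝ) else 0) := by
        refine Finset.sum_le_sum fun t _ => ?_
        split_ifs with ht
        · exact h.windowCov_le m _
        · rw [windowCov_of_le]
          simp only [Finset.mem_Ico, Nat.dist] at ht ⊢
          omega
    _ = (A ∩ Finset.Ico (s + 1 - m) (s + m)).card * 4 := by
        rw [Finset.sum_ite_mem, Finset.sum_const, nsmul_eq_mul]
    _ ≤ ((2 * m : ℕ) : ℝ) * 4 := by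
        gcongr
        refine (Finset.card_le_card Finset.inter_subset_right).trans ?_
        rw [Nat.card_Ico]; omega
    _ = 8 * m := by push_cast; ring

end IsBoundedIID

/-- Enlarging the square by the index `p` adds one diagonal term and each lag `1, …, p` twice. The
result is a sum of partial sums, ready for Cesàro averaging. -/
theorem sum_windowCov_dist_range (K C : ℝ) (m p : ℕ) :
    ∑ s ∈ Finset.range p, ∑ t ∈ Finset.range p, windowCov K C m (Nat.dist s t)
      = ∑ q ∈ Finset.range p,
        (windowCov K C m 0 + 2 * ∑ i ∈ Finset.Ico 1 (q + 1), windowCov K C m i) := by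
  induction p with
  | zero => simp
  | succ p ih =>
    have key : ∑ s ∈ Finset.range p, windowCov K C m (Nat.dist s p)
        = ∑ i ∈ Finset.Ico 1 (p + 1), windowCov K C m i := by
      rw [← Finset.sum_range_reflect, Finset.sum_Ico_eq_sum_range]
      refine Finset.sum_congr (by simp) fun s hs => ?_
      rw [Finset.mem_range] at hs
      congr 1
      simp only [Nat.dist]; omega
    rw [Finset.sum_range_succ (fun q => windowCov K C m 0 +
      2 * ∑ i ∈ Finset.Ico 1 (q + 1), windowCov K C m i) p, ← ih]
    simp_rw [Finset.sum_range_succ _ p]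
    rw [Finset.sum_add_distrib]
    simp_rw [Nat.dist_comm p]
    rw [key, Nat.dist_self]
    ring

/-- The long-run variance of the products of `m` consecutive terms. -/
noncomputable def longRunVar (K C : ℝ) (m : ℕ) : ℝ :=
  windowCov K C m 0 + 2 * ∑ i ∈ Finset.Ico 1 m, windowCov K C m i

/-- The factor `4` is the square of the `2` coming from the two equal projections of the symmetric
kernel. -/
theorem sigmaSq_eq (K C : ℝ) (m : ℕ) : sigmaSq K C m = 4 * longRunVar K C m := by
  have : ∑ i ∈ Finset.Ico 1 m, windowCov K C m i
      = ∑ i ∈ Finset.Ico 1 m, (K ^ (m - i) * C ^ (2 * i) - C ^ (2 * m)) := by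
    refine Finset.sum_congr rfl fun i hi => ?_
    rw [windowCov, min_eq_left (Finset.mem_Ico.1 hi).2.le]
  rw [sigmaSq, longRunVar, this, windowCov]
  simp
  ring

/-- The averaged partial sums are constant from `q = m` on; the factor `p / (p + m) → 1` accounts
for the gaps. -/
theorem tendsto_sum_windowCov_div (K C : ℝ) (m : ℕ) :
    Tendsto (fun p : ℕ => (∑ s ∈ Finset.range p, ∑ t ∈ Finset.range p,
      windowCov K C m (Nat.dist s t)) / ((p + m : ℕ) : ℝ)) atTop (𝓝 (longRunVar K C m)) := by
  have h1 : Tendsto (fun q : ℕ => windowCov K C m 0 +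
      2 * ∑ i ∈ Finset.Ico 1 (q + 1), windowCov K C m i) atTop (𝓝 (longRunVar K C m)) := by
    refine tendsto_const_nhds.congr' ?_
    filter_upwards [eventually_ge_atTop m] with q hq
    rw [longRunVar]
    congr 2
    refine Finset.sum_subset (Finset.Ico_subset_Ico_right (by omega)) fun i hi hi' => ?_
    refine windowCov_of_le ?_
    simp only [Finset.mem_Ico] at hi hi'
    omega
  have h2 := h1.cesaro
  have h3 : Tendsto (fun p : ℕ => (p : ℝ) / ((p : ℝ) + m)) atTop (𝓝 1) :=
    tendsto_natCast_div_add_atTop (m : ℝ)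
  have h4 := h2.mul h3
  rw [mul_one] at h4
  refine h4.congr' ?_
  filter_upwards [eventually_gt_atTop 0] with p hp
  rw [sum_windowCov_dist_range]
  have : (p : ℝ) ≠ 0 := by positivity
  push_cast
  field_simp

end

/-! ### Bernstein blocks and the central limit theorem for window products -/

theorem mul_add_injective {L : ℕ} : Function.Injective fun q : ℕ × Fin L => q.1 * L + q.2 := by
  rintro ⟨a, b⟩ ⟨c, d⟩ h
  have hL : 0 < L := b.pos
  simp only at h
  have h1 := congrArg (· / L) h
  have h2 := congrArg (· % L) h
  simp only [mul_comm _ L, Nat.mul_add_div hL, Nat.div_eq_of_lt b.2, Nat.div_eq_of_lt d.2,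
    add_zero, Nat.mul_add_mod, Nat.mod_eq_of_lt b.2, Nat.mod_eq_of_lt d.2] at h1 h2
  exact Prod.ext h1 (Fin.ext h2)

/-- The sum of the first `p` window products in a block of length `p + m`, as a function of the
entries of the block. -/
noncomputable def blockFun (C : ℝ) (m p : ℕ) (x : Fin (p + m) → ℝ) : ℝ :=
  ∑ r ∈ Finset.range p,
    -- The default `0` is never reached: `r < p` and `i < r + m` give `i < p + m`.
    (∏ i ∈ Finset.Ico r (r + m), (if h : i < p + m then x ⟨i, h⟩ else 0) - C ^ m)

theorem measurable_blockFun (C : ℝ) (m p : ℕ) : Measurable (blockFun C m p) := by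
  refine Finset.measurable_fun_sum _ fun r _ =>
    (Finset.measurable_fun_prod _ fun i _ => ?_).sub_const _
  split_ifs <;> fun_prop

/-- The `j`-th block sum of the window products. -/
noncomputable def blockSum {Ω : Type*} (G : ℕ → Ω → ℝ) (C : ℝ) (m p j : ℕ) (ω : Ω) : ℝ :=
  ∑ r ∈ Finset.range p, windowProd G C m (j * (p + m) + r) ω

theorem blockSum_eq {Ω : Type*} (G : ℕ → Ω → ℝ) (C : ℝ) (m p j : ℕ) (ω : Ω) :
    blockSum G C m p j ω = blockFun C m p fun k => G (j * (p + m) + k) ω := by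
  refine Finset.sum_congr rfl fun r hr => ?_
  rw [Finset.mem_range] at hr
  rw [windowProd, add_assoc, add_comm _ r, add_comm _ (r + m), ← Finset.prod_Ico_add]
  congr 1
  refine Finset.prod_congr rfl fun i hi => ?_
  rw [Finset.mem_Ico] at hi
  rw [dif_pos (by omega)]

/-- Presents the block sums as a subsum over distinct starting times, so that what remains of the
full sum is again a sum of window products. -/
theorem sum_blockSum {Ω : Type*} (G : ℕ → Ω → ℝ) (C : ℝ) (m p k : ℕ) :
    ∃ A ⊆ Finset.range (k * (p + m)), A.card = k * p ∧
      ∀ ω, ∑ j ∈ Finset.range k, blockSum G C m p j ω = ∑ t ∈ A, windowProd G C m t ω := by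
  classical
  have hinj : Set.InjOn (fun q : ℕ × ℕ => q.1 * (p + m) + q.2)
      (Finset.range k ×ˢ Finset.range p : Finset (ℕ × ℕ)) := by
    rintro ⟨a, b⟩ hab ⟨c, d⟩ hcd he
    simp only [Finset.coe_product, Set.mem_prod, Finset.mem_coe, Finset.mem_range] at hab hcd
    have := @mul_add_injective (p + m) (a, ⟨b, by omega⟩) (c, ⟨d, by omega⟩) he
    simp only [Prod.mk.injEq, Fin.mk.injEq] at this
    exact Prod.ext this.1 this.2
  refine ⟨(Finset.range k ×ˢ Finset.range p).image fun q => q.1 * (p + m) + q.2, ?_, ?_, ?_⟩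
  · intro t ht
    simp only [Finset.mem_image, Finset.mem_product, Finset.mem_range] at ht ⊢
    obtain ⟨⟨a, b⟩, ⟨ha, hb⟩, rfl⟩ := ht
    simp only at ha hb ⊢
    calc a * (p + m) + b < a * (p + m) + (p + m) := by omega
      _ = (a + 1) * (p + m) := by ring
      _ ≤ k * (p + m) := Nat.mul_le_mul_right _ ha
  · rw [Finset.card_image_of_injOn hinj]; simp
  · intro ω
    rw [Finset.sum_image hinj, Finset.sum_product]
    rfl

section

variable {Ω : Type*} [MeasurableSpace Ω] {P : Measure Ω} {G : ℕ → Ω → ℝ} {C K : ℝ}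

namespace IsBoundedIID

/-- A window starting in the first `p` places of a block ends inside that block, so different block
sums read disjoint stretches of `G`. -/
theorem iIndepFun_blockSum (h : IsBoundedIID P G C K) (m p : ℕ) :
    iIndepFun (blockSum G C m p) P := by
  have h1 := iIndepFun_curry (X := fun (q : ℕ × Fin (p + m)) => G (q.1 * (p + m) + q.2))
    (fun q => h.measurable _) (h.indep.precomp mul_add_injective)
  have h2 := h1.comp (fun _ => blockFun C m p) fun _ => measurable_blockFun C m p
  convert! h2 using 2 with j
  funext ω
  exact blockSum_eq G C m p j ω

theorem identDistrib_blockSum (h : IsBoundedIID P G C K) (m p j : ℕ) :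
    IdentDistrib (blockSum G C m p j) (blockSum G C m p 0) P P := by
  have hinj : ∀ a : ℕ, Function.Injective fun k : Fin (p + m) => a * (p + m) + (k : ℕ) :=
    fun a k l hkl => by ext; simpa using hkl
  have h1 := IdentDistrib.pi (X := fun (k : Fin (p + m)) => G (j * (p + m) + k))
    (Y := fun (k : Fin (p + m)) => G (0 * (p + m) + k))
    (fun k => (h.ident _).trans (h.ident _).symm) (h.indep.precomp (hinj j))
    (h.indep.precomp (hinj 0))
  have h2 := h1.comp (measurable_blockFun C m p)
  convert! h2 using 1 <;> funext ω <;> exact blockSum_eq G C m p _ ω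

variable [IsProbabilityMeasure P]

theorem memLp_sum_windowProd (h : IsBoundedIID P G C K) (m : ℕ) (A : Finset ℕ) :
    MemLp (fun ω => ∑ t ∈ A, windowProd G C m t ω) 2 P :=
  memLp_finsetSum _ fun t _ => h.memLp_windowProd m t

theorem memLp_blockSum (h : IsBoundedIID P G C K) (m p j : ℕ) :
    MemLp (blockSum G C m p j) 2 P :=
  memLp_finsetSum _ fun _ _ => h.memLp_windowProd m _

theorem integral_blockSum (h : IsBoundedIID P G C K) (m p j : ℕ) :
    ∫ ω, blockSum G C m p j ω ∂P = 0 := by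
  simp only [blockSum]
  rw [integral_finsetSum _ fun t _ => (h.memLp_windowProd m _).integrable (by norm_num)]
  exact Finset.sum_eq_zero fun t _ => h.integral_windowProd m _

/-- The variance of a block sum. -/
theorem variance_blockSum (h : IsBoundedIID P G C K) (m p : ℕ) :
    variance (blockSum G C m p 0) P = ∑ s ∈ Finset.range p, ∑ t ∈ Finset.range p,
      windowCov K C m (Nat.dist s t) := by
  rw [variance_eq_sub (h.memLp_blockSum m p 0), h.integral_blockSum, ← h.integral_sum_sq]
  simp [blockSum]

/-- The i.i.d. theorem applies along the number `k = n / (p + m)` of blocks; since `k / n → 1 / (p +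
m)`, Slutsky's lemma replaces `√k` by `√n`. -/
theorem tendstoInDistribution_sum_blockSum (h : IsBoundedIID P G C K) {m : ℕ} (hm : 1 ≤ m)
    (p : ℕ) :
    TendstoInDistribution (fun (n : ℕ) ω =>
        (√n)⁻¹ * ∑ j ∈ Finset.range (n / (p + m)), blockSum G C m p j ω) atTop id
      (fun _ => P)
      (gaussianReal 0 (variance (blockSum G C m p 0) P / ((p + m : ℕ) : ℝ)).toNNReal) := by
  set L := p + m with hL
  have hL0 : 0 < L := by omega
  set V := variance (blockSum G C m p 0) P
  have h1 := tendstoInDistribution_inv_sqrt_mul_sum_sub (P := P) (Y := id)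
    (P' := gaussianReal 0 V.toNNReal) (X := blockSum G C m p) ⟨by fun_prop, by simp [V]⟩
    (h.memLp_blockSum m p 0) (h.iIndepFun_blockSum m p) (h.identDistrib_blockSum m p)
  simp only [h.integral_blockSum, mul_zero, sub_zero] at h1
  have hdiv : Tendsto (fun n : ℕ => n / L) atTop atTop := Nat.tendsto_div_const_atTop hL0.ne'
  have h2 : TendstoInDistribution (fun (n : ℕ) ω =>
        (√(n / L : ℕ))⁻¹ * ∑ j ∈ Finset.range (n / L), blockSum G C m p j ω) atTop id
      (fun _ => P) (gaussianReal 0 V.toNNReal) :=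
    ⟨fun n => h1.forall_aemeasurable _, h1.aemeasurable_limit, h1.tendsto.comp hdiv⟩
  have hc : Tendsto (fun n : ℕ => √(((n / L : ℕ) : ℝ) / n)) atTop (𝓝 √(1 / L)) := by
    refine Tendsto.sqrt ?_
    have := (tendsto_nat_floor_mul_div_atTop (R := ℝ) (a := 1 / L) (by positivity)).comp
      tendsto_natCast_atTop_atTop
    refine this.congr fun n => ?_
    simp only [Function.comp]
    rw [one_div, mul_comm, ← div_eq_mul_inv, Nat.floor_div_eq_div]
  have hc' : TendstoInMeasure P (fun (n : ℕ) (_ : Ω) => √(((n / L : ℕ) : ℝ) / n)) atTop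
      (fun _ => √(1 / L)) :=
    tendstoInMeasure_of_tendsto_ae (fun n => aestronglyMeasurable_const)
      (ae_of_all _ fun _ => hc)
  have h3 := h2.continuous_comp_prodMk_of_tendstoInMeasure_const
    (g := fun q : ℝ × ℝ => q.1 * q.2) (by fun_prop) hc' (fun _ => aemeasurable_const)
  have h4 : (gaussianReal 0 V.toNNReal).map (fun x => id x * √(1 / L))
      = gaussianReal 0 (V / (L : ℝ)).toNNReal := by
    simp only [id]
    rw [gaussianReal_map_mul_const]
    congr 1
    · simp
    · ext
      have hV : 0 ≤ V := variance_nonneg _ _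
      simp only [NNReal.coe_mul, NNReal.coe_mk, Real.coe_toNNReal _ hV,
        Real.coe_toNNReal _ (show 0 ≤ V / (L : ℝ) by positivity)]
      rw [Real.sq_sqrt (by positivity)]
      ring
  have h5 : TendstoInDistribution (fun (n : ℕ) ω =>
      ((√(n / L : ℕ))⁻¹ * ∑ j ∈ Finset.range (n / L), blockSum G C m p j ω)
        * √(((n / L : ℕ) : ℝ) / n)) atTop id
      (fun _ => P) (gaussianReal 0 (V / (L : ℝ)).toNNReal) :=
    TendstoInDistribution.id_of_map_eq h3 h4
  refine h5.congr (fun n => ae_of_all _ fun ω => ?_) (ae_of_all _ fun _ => rfl)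
  rcases Nat.eq_zero_or_pos (n / L) with h0 | h0
  · simp [h0]
  · have : √((n / L : ℕ) : ℝ) ≠ 0 := by positivity
    simp only
    rw [Real.sqrt_div (by positivity)]
    field_simp

/-- Central limit theorem for products of `m` consecutive terms of a bounded i.i.d. sequence. -/
theorem tendstoInDistribution_sum_windowProd (h : IsBoundedIID P G C K) {m : ℕ} (hm : 1 ≤ m) :
    TendstoInDistribution (fun (n : ℕ) ω =>
        (√n)⁻¹ * ∑ t ∈ Finset.range n, windowProd G C m t ω) atTop id
      (fun _ => P) (gaussianReal 0 (longRunVar K C m).toNNReal) := by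
  have hsum : ∀ p n : ℕ, ∃ D : Finset ℕ, D.card = n - n / (p + m) * p ∧ ∀ ω,
      ∑ t ∈ Finset.range n, windowProd G C m t ω
        - ∑ j ∈ Finset.range (n / (p + m)), blockSum G C m p j ω
      = ∑ t ∈ D, windowProd G C m t ω := fun p n => by
    obtain ⟨A, hA, hAc, hAs⟩ := sum_blockSum G C m p (n / (p + m))
    have hA' : A ⊆ Finset.range n :=
      hA.trans (Finset.range_subset_range.2 (Nat.div_mul_le_self _ _))
    refine ⟨Finset.range n \ A, by rw [Finset.card_sdiff_of_subset hA', hAc, Finset.card_range],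
      fun ω => ?_⟩
    rw [hAs, ← Finset.sum_sdiff hA']
    ring
  have hdiff : ∀ p n : ℕ, ∃ D : Finset ℕ, D.card = n - n / (p + m) * p ∧ ∀ ω,
      (√n)⁻¹ * ∑ t ∈ Finset.range n, windowProd G C m t ω
        - (√n)⁻¹ * ∑ j ∈ Finset.range (n / (p + m)), blockSum G C m p j ω
      = (√n)⁻¹ * ∑ t ∈ D, windowProd G C m t ω := fun p n => by
    obtain ⟨D, hD, hs⟩ := hsum p n
    exact ⟨D, hD, fun ω => by rw [← hs, mul_sub]⟩
  -- At most `n / (p + m) * m + (p + m)` times are left over: `m` per block and an incomplete last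
  -- block. For `n ≥ (p + m) ^ 2` this is at most `n * (m + 1) / (p + m)`, and `integral_sum_sq_le`
  -- contributes `8 * m`.
  refine tendstoInDistribution_gaussian_of_approx
    (a := fun p : ℕ => 8 * m * (m + 1) / ((p : ℝ) + m))
    (fun n => ((h.memLp_sum_windowProd m _).aestronglyMeasurable.aemeasurable).const_mul _)
    (h.tendstoInDistribution_sum_blockSum hm) ?_ ?_ ?_ ?_
  · refine (continuous_real_toNNReal.tendsto _).comp ?_
    simp_rw [h.variance_blockSum]
    exact tendsto_sum_windowCov_div K C m
  · intro p n
    obtain ⟨D, -, hs⟩ := hdiff p n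
    simp_rw [hs]
    exact (h.memLp_sum_windowProd m D).const_mul _
  · intro p
    filter_upwards [eventually_ge_atTop ((p + m) ^ 2)] with n hn
    obtain ⟨D, hD, hs⟩ := hdiff p n
    have hn0 : 0 < n := lt_of_lt_of_le (by positivity) hn
    simp_rw [hs, mul_pow]
    rw [integral_const_mul, inv_pow, Real.sq_sqrt (by positivity)]
    have hb := h.integral_sum_sq_le m D
    have hcard : D.card * (p + m) ≤ n * (m + 1) := by
      have h1 : n / (p + m) * (p + m) + n % (p + m) = n := Nat.div_add_mod' _ _
      have h2 : n % (p + m) < p + m := Nat.mod_lt _ (by omega)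
      have h3 : D.card ≤ n / (p + m) * m + (p + m) := by
        rw [mul_add] at h1; omega
      calc D.card * (p + m) ≤ (n / (p + m) * m + (p + m)) * (p + m) := Nat.mul_le_mul_right _ h3
        _ = n / (p + m) * (p + m) * m + (p + m) ^ 2 := by ring
        _ ≤ n * m + n := by gcongr; exact Nat.div_mul_le_self _ _
        _ = n * (m + 1) := by ring
    have hcard' : (D.card : ℝ) * (p + m) ≤ n * (m + 1) := by exact_mod_cast hcard
    rw [inv_mul_le_iff₀ (by positivity)]
    refine hb.trans ?_
    rw [← mul_div_assoc, le_div_iff₀ (by positivity)]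
    nlinarith [mul_le_mul_of_nonneg_left hcard' (show (0 : ℝ) ≤ 8 * m by positivity)]
  · exact tendsto_const_nhds.div_atTop
      (tendsto_atTop_add_const_right _ _ tendsto_natCast_atTop_atTop)

end IsBoundedIID

end

/-! ### Second moments of degenerate sums over pairs -/

/-- The indicator that two integers are at distance less than `2 m`. -/
noncomputable def nearWeight (m : ℕ) (p q : ℤ) : ℝ := if q ∈ Finset.Ioo (p - 2 * m) (p + 2 * m) then 1 else 0

theorem nearWeight_nonneg (m : ℕ) (p q : ℤ) : 0 ≤ nearWeight m p q := by
  unfold nearWeight; split_ifs <;> norm_num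

theorem nearWeight_eq_one {m : ℕ} {p q : ℤ} (h1 : p - 2 * m < q) (h2 : q < p + 2 * m) :
    nearWeight m p q = 1 := by
  simp [nearWeight, h1, h2]

theorem sum_nearWeight_le (m : ℕ) (S : Finset ℤ) :
    ∑ p ∈ S, ∑ q ∈ S, nearWeight m p q ≤ S.card * (4 * m) := by
  rw [← nsmul_eq_mul]
  refine Finset.sum_le_card_nsmul _ _ _ fun p _ => ?_
  simp only [nearWeight]
  rw [Finset.sum_ite_mem, Finset.sum_const, nsmul_eq_mul, mul_one]
  have h : (S ∩ Finset.Ioo (p - 2 * (m : ℤ)) (p + 2 * m)).card ≤ 4 * m :=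
    (Finset.card_le_card Finset.inter_subset_right).trans (by rw [Int.card_Ioo]; omega)
  exact_mod_cast h

/-- The total weight of the perfect matchings of four integers into near pairs. -/
noncomputable def matchWeight (m : ℕ) (a b c d : ℤ) : ℝ :=
  nearWeight m a b * nearWeight m c d + nearWeight m a c * nearWeight m b d
    + nearWeight m a d * nearWeight m b c

theorem matchWeight_nonneg (m : ℕ) (a b c d : ℤ) : 0 ≤ matchWeight m a b c d := by
  have := nearWeight_nonneg m
  unfold matchWeight
  have h1 := mul_nonneg (this a b) (this c d)
  have h2 := mul_nonneg (this a c) (this b d)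
  have h3 := mul_nonneg (this a d) (this b c)
  linarith

/-- For each of the three matchings the fourfold sum separates into the square of a sum over near
pairs, hence order `S.card ^ 2` instead of `S.card ^ 4`. -/
theorem sum_matchWeight_le (m : ℕ) (S : Finset ℤ) :
    ∑ a ∈ S, ∑ b ∈ S, ∑ c ∈ S, ∑ d ∈ S, matchWeight m a b c d ≤ 3 * (S.card * (4 * m)) ^ 2 := by
  set W := ∑ p ∈ S, ∑ q ∈ S, nearWeight m p q with hW
  have hW0 : 0 ≤ W := Finset.sum_nonneg fun p _ => Finset.sum_nonneg fun q _ =>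
    nearWeight_nonneg m p q
  have h1 : ∑ a ∈ S, ∑ b ∈ S, ∑ c ∈ S, ∑ d ∈ S, nearWeight m a b * nearWeight m c d = W ^ 2 := by
    simp_rw [sq, hW, Finset.sum_mul, Finset.mul_sum]
  have h2 : ∑ a ∈ S, ∑ b ∈ S, ∑ c ∈ S, ∑ d ∈ S, nearWeight m a c * nearWeight m b d = W ^ 2 := by
    rw [← h1]
    exact Finset.sum_congr rfl fun a _ => Finset.sum_comm
  have h3 : ∑ a ∈ S, ∑ b ∈ S, ∑ c ∈ S, ∑ d ∈ S, nearWeight m a d * nearWeight m b c = W ^ 2 := by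
    rw [← h2]
    exact Finset.sum_congr rfl fun a _ => Finset.sum_congr rfl fun b _ => Finset.sum_comm
  simp only [matchWeight, Finset.sum_add_distrib]
  rw [h1, h2, h3]
  have : W ^ 2 ≤ (S.card * (4 * m)) ^ 2 := by
    gcongr; exact sum_nearWeight_le m S
  linarith

/-- Two integers are at distance at least `m`. -/
def Far (m : ℕ) (a b : ℤ) : Prop := a + m ≤ b ∨ b + m ≤ a

/-- Join two of the four times when their distance is below `m`. A graph on four vertices without
isolated vertex has a perfect matching or is a star; two leaves of a star are at distance below `2 *
m`, which is why `nearWeight` uses `2 * m`. -/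
theorem one_le_matchWeight {m : ℕ} {a b c d : ℤ}
    (ha : ¬(Far m a b ∧ Far m a c ∧ Far m a d)) (hb : ¬(Far m b a ∧ Far m b c ∧ Far m b d))
    (hc : ¬(Far m c a ∧ Far m c b ∧ Far m c d)) (hd : ¬(Far m d a ∧ Far m d b ∧ Far m d c)) :
    1 ≤ matchWeight m a b c d := by
  have hn := nearWeight_nonneg m
  have h1 := mul_nonneg (hn a b) (hn c d)
  have h2 := mul_nonneg (hn a c) (hn b d)
  have h3 := mul_nonneg (hn a d) (hn b c)
  have key : ((a - 2 * m < b ∧ b < a + 2 * m) ∧ (c - 2 * m < d ∧ d < c + 2 * m)) ∨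
      ((a - 2 * m < c ∧ c < a + 2 * m) ∧ (b - 2 * m < d ∧ d < b + 2 * m)) ∨
      ((a - 2 * m < d ∧ d < a + 2 * m) ∧ (b - 2 * m < c ∧ c < b + 2 * m)) := by
    simp only [Far, not_and_or, not_or, not_le] at ha hb hc hd
    rcases ha with ha | ha | ha <;> rcases hb with hb | hb | hb <;>
      rcases hc with hc | hc | hc <;> rcases hd with hd | hd | hd <;> omega
  unfold matchWeight
  rcases key with ⟨⟨u, v⟩, u', v'⟩ | ⟨⟨u, v⟩, u', v'⟩ | ⟨⟨u, v⟩, u', v'⟩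
  all_goals
    have e1 := nearWeight_eq_one u v
    have e2 := nearWeight_eq_one u' v'
    rw [e1, e2] at *
    linarith

section

variable {Ω E : Type*} [MeasurableSpace Ω] [MeasurableSpace E] {P : Measure Ω}
  [IsProbabilityMeasure P] {Y : ℤ → Ω → E} {f : E → E → ℝ} {m : ℕ} {ν : Measure E}
  {B : ℝ}

/-- Products of a degenerate kernel have mean zero if one of the four random elements is
independent of the others. -/
theorem integral_degenerate_mul_eq_zero (hY : ∀ t, Measurable (Y t))
    (hν : ∀ t, P.map (Y t) = ν) (hf : Measurable fun q : E × E => f q.1 q.2)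
    (hB : ∀ x y, |f x y| ≤ B) (hdeg : ∀ y, ∫ x, f x y ∂ν = 0) {a b c d : ℤ}
    (hind : IndepFun (Y a) (fun ω => (Y b ω, Y c ω, Y d ω)) P) :
    ∫ ω, f (Y a ω) (Y b ω) * f (Y c ω) (Y d ω) ∂P = 0 := by
  have hZ : Measurable fun ω => (Y b ω, Y c ω, Y d ω) := by fun_prop
  let F : E × E × E × E → ℝ := fun q => f q.1 q.2.1 * f q.2.2.1 q.2.2.2
  have hF : Measurable F :=
    (hf.comp (f := fun q : E × E × E × E => (q.1, q.2.1)) (by fun_prop)).mul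
      (hf.comp (f := fun q : E × E × E × E => (q.2.2.1, q.2.2.2)) (by fun_prop))
  have h1 := (indepFun_iff_map_prod_eq_prod_map_map (hY a).aemeasurable hZ.aemeasurable).1 hind
  rw [hν a] at h1
  have h2 : ∫ ω, f (Y a ω) (Y b ω) * f (Y c ω) (Y d ω) ∂P
      = ∫ q, F q ∂(P.map fun ω => (Y a ω, Y b ω, Y c ω, Y d ω)) := by
    rw [integral_map (by fun_prop) hF.aestronglyMeasurable]
  have : IsProbabilityMeasure ν := by
    rw [← hν a]; exact Measure.isProbabilityMeasure_map (hY a).aemeasurable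
  have : IsProbabilityMeasure (P.map fun ω => (Y b ω, Y c ω, Y d ω)) :=
    Measure.isProbabilityMeasure_map hZ.aemeasurable
  -- The joint law is a product, so `Y a` can be integrated first with the other three fixed;
  -- degeneracy makes that inner integral `0`.
  rw [h2, h1, integral_prod_symm]
  · simp only [F, integral_mul_const, hdeg, zero_mul, integral_zero]
  · refine Integrable.of_bound hF.aestronglyMeasurable (B * B) (ae_of_all _ fun q => ?_)
    simp only [F, norm_mul, Real.norm_eq_abs]
    have := hB q.1 q.2.1
    exact mul_le_mul this (hB _ _) (abs_nonneg _) ((abs_nonneg _).trans this)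

/-- Second moment bound for sums of a degenerate kernel over pairs of terms of an
`m`-dependent sequence. -/
theorem integral_sum_degenerate_sq_le (hY : ∀ t, Measurable (Y t))
    (hν : ∀ t, P.map (Y t) = ν) (hf : Measurable fun q : E × E => f q.1 q.2)
    (hsymm : ∀ x y, f x y = f y x)
    (hB : ∀ x y, |f x y| ≤ B) (hdeg : ∀ y, ∫ x, f x y ∂ν = 0)
    (hind : ∀ a b c d, Far m a b → Far m a c → Far m a d →
      IndepFun (Y a) (fun ω => (Y b ω, Y c ω, Y d ω)) P)
    (S : Finset ℤ) {Q : Finset (ℤ × ℤ)} (hQ : Q ⊆ S ×ˢ S) :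
    ∫ ω, (∑ q ∈ Q, f (Y q.1 ω) (Y q.2 ω)) ^ 2 ∂P ≤ B ^ 2 * (3 * (S.card * (4 * m)) ^ 2) := by
  have hfm : ∀ a b, Measurable fun ω => f (Y a ω) (Y b ω) := fun a b =>
    hf.comp ((hY a).prodMk (hY b))
  have hb : ∀ a b c d ω, ‖f (Y a ω) (Y b ω) * f (Y c ω) (Y d ω)‖ ≤ B ^ 2 := by
    intro a b c d ω
    rw [norm_mul, sq]
    have := hB (Y a ω) (Y b ω)
    exact mul_le_mul this (hB _ _) (abs_nonneg _) ((abs_nonneg _).trans this)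
  have hi : ∀ a b c d, Integrable (fun ω => f (Y a ω) (Y b ω) * f (Y c ω) (Y d ω)) P :=
    fun a b c d => Integrable.of_bound ((hfm a b).mul (hfm c d)).aestronglyMeasurable (B ^ 2)
      (ae_of_all _ fun ω => hb a b c d ω)
  have hterm : ∀ a b c d, ∫ ω, f (Y a ω) (Y b ω) * f (Y c ω) (Y d ω) ∂P
      ≤ B ^ 2 * matchWeight m a b c d := by
    intro a b c d
    have h0 : 0 ≤ B ^ 2 * matchWeight m a b c d :=
      mul_nonneg (sq_nonneg _) (matchWeight_nonneg m a b c d)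
    have hzero := fun {a b c d : ℤ} (h : Far m a b ∧ Far m a c ∧ Far m a d) =>
      integral_degenerate_mul_eq_zero hY hν hf hB hdeg (hind a b c d h.1 h.2.1 h.2.2)
    -- Symmetry of `f` and commutativity of the product bring any isolated time into first position.
    by_cases ha : Far m a b ∧ Far m a c ∧ Far m a d
    · rw [hzero ha]; exact h0
    by_cases hb' : Far m b a ∧ Far m b c ∧ Far m b d
    · simp_rw [hsymm (Y a _) (Y b _)]
      rw [hzero hb']; exact h0
    by_cases hc : Far m c a ∧ Far m c b ∧ Far m c d
    · simp_rw [mul_comm (f (Y a _) (Y b _))]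
      rw [hzero ⟨hc.2.2, hc.1, hc.2.1⟩]; exact h0
    by_cases hd : Far m d a ∧ Far m d b ∧ Far m d c
    · simp_rw [mul_comm (f (Y a _) (Y b _)), hsymm (Y c _) (Y d _)]
      rw [hzero ⟨hd.2.2, hd.1, hd.2.1⟩]; exact h0
    refine (le_abs_self _).trans ?_
    have := norm_integral_le_of_norm_le_const (μ := P) (ae_of_all _ (hb a b c d))
    simp only [probReal_univ, mul_one, Real.norm_eq_abs] at this
    refine this.trans ?_
    exact le_mul_of_one_le_right (sq_nonneg _) (one_le_matchWeight ha hb' hc hd)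
  simp_rw [sq (∑ q ∈ Q, _), Finset.sum_mul_sum]
  rw [integral_finsetSum _ fun q _ => integrable_finsetSum _ fun r _ => hi q.1 q.2 r.1 r.2]
  simp_rw [integral_finsetSum Q fun r _ => hi _ _ r.1 r.2]
  have hw : ∀ q r : ℤ × ℤ, 0 ≤ B ^ 2 * matchWeight m q.1 q.2 r.1 r.2 := fun q r =>
    mul_nonneg (sq_nonneg _) (matchWeight_nonneg m _ _ _ _)
  calc _ ≤ ∑ q ∈ Q, ∑ r ∈ Q, B ^ 2 * matchWeight m q.1 q.2 r.1 r.2 :=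
        Finset.sum_le_sum fun q _ => Finset.sum_le_sum fun r _ => hterm _ _ _ _
    -- The bounds, unlike the integrals, are nonnegative, so the sum may be extended from `Q` to all
    -- pairs.
    _ ≤ ∑ q ∈ S ×ˢ S, ∑ r ∈ S ×ˢ S, B ^ 2 * matchWeight m q.1 q.2 r.1 r.2 := by
        refine (Finset.sum_le_sum fun q _ => Finset.sum_le_sum_of_subset_of_nonneg hQ
          fun r _ _ => hw q r).trans ?_
        exact Finset.sum_le_sum_of_subset_of_nonneg hQ
          fun q _ _ => Finset.sum_nonneg fun r _ => hw q r
    _ = B ^ 2 * ∑ a ∈ S, ∑ b ∈ S, ∑ c ∈ S, ∑ d ∈ S, matchWeight m a b c d := by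
        simp_rw [Finset.sum_product, Finset.mul_sum]
    _ ≤ _ := by gcongr; exact sum_matchWeight_le m S

end

/-! ### Independence of distant histories; the correlation kernel and its projections -/

/-- Histories at distance at least `m` are independent. -/
theorem indepFun_history {Ω H : Type*} [MeasurableSpace Ω] [MeasurableSpace H] {P : Measure Ω}
    {X : ℤ → Ω → H} (hX : ∀ t, Measurable (X t)) (hind : iIndepFun X P) (m : ℕ) {a b c d : ℤ}
    (hb : Far m a b) (hc : Far m a c) (hd : Far m a d) :
    IndepFun (history X m a)
      (fun ω => (history X m b ω, history X m c ω, history X m d ω)) P := by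
  let I : ℤ → Finset ℤ := fun a => Finset.Ico a (a + m)
  have hI : ∀ {a b}, Far m a b → Disjoint (I a) (I b) := by
    intro a b hab
    rw [Finset.disjoint_left]
    intro t ht ht'
    simp only [I, Finset.mem_Ico] at ht ht'
    rcases hab with hab | hab <;> omega
  have hmem : ∀ (a : ℤ) (k : Fin m), a + ((k : ℕ) : ℤ) ∈ I a := fun a k => by
    have := k.2
    simp only [I, Finset.mem_Ico]; omega
  -- The last three windows may overlap one another; only their union has to avoid the window of
  -- `a`.
  set T := I b ∪ (I c ∪ I d)
  have hdis : Disjoint (I a) T :=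
    Finset.disjoint_union_right.2 ⟨hI hb, Finset.disjoint_union_right.2 ⟨hI hc, hI hd⟩⟩
  have h := hind.indepFun_finset (I a) T hdis hX
  have hbT : ∀ k : Fin m, b + ((k : ℕ) : ℤ) ∈ T := fun k => by simp [T, hmem]
  have hcT : ∀ k : Fin m, c + ((k : ℕ) : ℤ) ∈ T := fun k => by simp [T, hmem]
  have hdT : ∀ k : Fin m, d + ((k : ℕ) : ℤ) ∈ T := fun k => by simp [T, hmem]
  exact h.comp (φ := fun (x : I a → H) (k : Fin m) => x ⟨_, hmem a k⟩)
    (ψ := fun x : T → H => ((fun k : Fin m => x ⟨_, hbT k⟩), (fun k : Fin m => x ⟨_, hcT k⟩),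
      fun k : Fin m => x ⟨_, hdT k⟩)) (by fun_prop) (by fun_prop)

theorem measurable_indic (ε : ℝ) : Measurable (indic ε) :=
  measurable_const.indicator measurableSet_Ico

theorem indic_nonneg (ε r : ℝ) : 0 ≤ indic ε r :=
  Set.indicator_nonneg (fun _ _ => zero_le_one) _

theorem indic_le_one (ε r : ℝ) : indic ε r ≤ 1 :=
  Set.indicator_le_self' (fun _ _ => zero_le_one) _ |>.trans le_rfl

theorem indic_of_nonneg {ε r : ℝ} (hr : 0 ≤ r) : indic ε r = if r < ε then 1 else 0 := by
  simp [indic, Set.indicator_apply, hr]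

theorem indic_maxNorm {H : Type*} {N : H → ℝ} (hN : ∀ x, 0 ≤ N x) {m : ℕ} (hm : 1 ≤ m) (ε : ℝ)
    (x : Fin m → H) : indic ε (maxNorm N x) = ∏ k, indic ε (N (x k)) := by
  have : Nonempty (Fin m) := ⟨⟨0, hm⟩⟩
  have h0 : 0 ≤ maxNorm N x := Real.iSup_nonneg fun k => hN _
  have hlt : maxNorm N x < ε ↔ ∀ k, N (x k) < ε := by
    constructor
    · exact fun h k => (le_ciSup (f := fun k => N (x k)) (Set.finite_range _).bddAbove k).trans_lt h
    · intro h
      obtain ⟨k, hk⟩ := exists_eq_ciSup_of_finite (f := fun k => N (x k))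
      rw [maxNorm, ← hk]
      exact h k
  simp only [indic_of_nonneg h0, indic_of_nonneg (hN _), hlt]
  rw [Finset.prod_ite_zero]
  simp

section

variable {𝕜 H : Type*} [RCLike 𝕜] [NormedAddCommGroup H] [InnerProductSpace 𝕜 H]

theorem indic_seminorm_sub_comm (N : Seminorm 𝕜 H) (ε : ℝ) (x y : H) :
    indic ε (N (x - y)) = indic ε (N (y - x)) := by
  rw [map_sub_rev]

theorem corrKernel_eq_prod (N : Seminorm 𝕜 H) {m : ℕ} (hm : 1 ≤ m) (ε : ℝ) (x y : Fin m → H) :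
    corrKernel (N : H → ℝ) m ε x y = ∏ k, indic ε (N (x k - y k)) :=
  indic_maxNorm (fun x => apply_nonneg N x) hm ε (x - y)

theorem corrKernel_self (N : Seminorm 𝕜 H) {m : ℕ} (hm : 1 ≤ m) {ε : ℝ} (hε : 0 < ε)
    (x : Fin m → H) : corrKernel (N : H → ℝ) m ε x x = 1 := by
  rw [corrKernel_eq_prod N hm]
  simp [indic_of_nonneg, hε]

theorem abs_corrKernel_le (N : Seminorm 𝕜 H) (m : ℕ) (ε : ℝ) (x y : Fin m → H) :
    |corrKernel (N : H → ℝ) m ε x y| ≤ 1 := by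
  rw [corrKernel, abs_of_nonneg (indic_nonneg _ _)]
  exact indic_le_one _ _

variable [MeasurableSpace H]

/-- The mass of the ball of radius `ε` around `y`. -/
noncomputable def ballMass (N : Seminorm 𝕜 H) (μ : Measure H) (ε : ℝ) (y : H) : ℝ :=
  ∫ x, indic ε (N (x - y)) ∂μ

theorem abs_ballMass_le (N : Seminorm 𝕜 H) (μ : Measure H) [IsProbabilityMeasure μ] (ε : ℝ)
    (y : H) : |ballMass N μ ε y| ≤ 1 := by
  have := norm_integral_le_of_norm_le_const (μ := μ) (f := fun x => indic ε (N (x - y))) (C := 1)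
    (ae_of_all _ fun x => by
      rw [Real.norm_eq_abs, abs_of_nonneg (indic_nonneg _ _)]; exact indic_le_one _ _)
  simpa [ballMass] using this

/-- The factorised kernel integrates factor by factor, so its projection is a product of functions
of single coordinates. -/
theorem integral_corrKernel (N : Seminorm 𝕜 H) (μ : Measure H) [IsProbabilityMeasure μ]
    {m : ℕ} (hm : 1 ≤ m) (ε : ℝ) (y : Fin m → H) :
    ∫ x, corrKernel (N : H → ℝ) m ε x y ∂(Measure.pi fun _ => μ)
      = ∏ k, ballMass N μ ε (y k) := by
  simp_rw [corrKernel_eq_prod N hm]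
  exact integral_fintype_prod_eq_prod (fun k x => indic ε (N (x - y k)))

theorem integral_prod_ballMass (N : Seminorm 𝕜 H) (μ : Measure H) [IsProbabilityMeasure μ]
    (m : ℕ) (ε : ℝ) :
    ∫ y : Fin m → H, ∏ k, ballMass N μ ε (y k) ∂(Measure.pi fun _ => μ)
      = corrC (N : H → ℝ) μ ε ^ m := by
  rw [integral_fintype_prod_eq_prod (fun _ y => ballMass N μ ε y)]
  simp [corrC, ballMass]

/-- The completely degenerate part of the correlation kernel. -/
noncomputable def degenerateKernel (N : Seminorm 𝕜 H) (μ : Measure H) (m : ℕ) (ε : ℝ)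
    (x y : Fin m → H) : ℝ :=
  corrKernel (N : H → ℝ) m ε x y - ∏ k, ballMass N μ ε (x k) - ∏ k, ballMass N μ ε (y k)
    + corrC (N : H → ℝ) μ ε ^ m

theorem abs_prod_ballMass_le (N : Seminorm 𝕜 H) (μ : Measure H) [IsProbabilityMeasure μ]
    {m : ℕ} (ε : ℝ) (y : Fin m → H) : |∏ k, ballMass N μ ε (y k)| ≤ 1 := by
  rw [Finset.abs_prod]
  exact Finset.prod_le_one (fun _ _ => abs_nonneg _) fun j _ => abs_ballMass_le N μ ε _

theorem abs_degenerateKernel_le (N : Seminorm 𝕜 H) (μ : Measure H) [IsProbabilityMeasure μ]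
    {m : ℕ} (ε : ℝ) (x y : Fin m → H) : |degenerateKernel N μ m ε x y| ≤ 4 := by
  have h1 := abs_le.1 (abs_corrKernel_le N m ε x y)
  have h2 := abs_le.1 (abs_prod_ballMass_le N μ ε x)
  have h3 := abs_le.1 (abs_prod_ballMass_le N μ ε y)
  have h4 : |corrC (N : H → ℝ) μ ε ^ m| ≤ 1 := by
    rw [← integral_prod_ballMass]
    have := norm_integral_le_of_norm_le_const (μ := Measure.pi fun _ : Fin m => μ)
      (f := fun y => ∏ k, ballMass N μ ε (y k)) (C := 1)
      (ae_of_all _ fun y => abs_prod_ballMass_le N μ ε y)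
    simpa using this
  have h4 := abs_le.1 h4
  rw [degenerateKernel, abs_le]
  constructor <;> linarith [h1.1, h1.2, h2.1, h2.2, h3.1, h3.2, h4.1, h4.2]

variable [TopologicalSpace.SeparableSpace H] [BorelSpace H]

theorem measurable_indic_sub {N : Seminorm 𝕜 H} (hN : Measurable N) (ε : ℝ) :
    Measurable fun q : H × H => indic ε (N (q.1 - q.2)) := by
  -- Second countability makes subtraction jointly measurable for the product of the Borel σ-fields.
  have : SecondCountableTopology H := UniformSpace.secondCountable_of_separable H
  exact (measurable_indic ε).comp (hN.comp (measurable_fst.sub measurable_snd))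

theorem isKernelTwo_corrKernel {N : Seminorm 𝕜 H} (hN : Measurable N) {m : ℕ} (hm : 1 ≤ m)
    (ε : ℝ) : IsKernelTwo (corrKernel (N : H → ℝ) m ε) where
  measurable := by
    simp_rw [corrKernel_eq_prod N hm]
    exact Finset.measurable_fun_prod _ fun k _ =>
      (measurable_indic_sub hN ε).comp (f := fun q : (Fin m → H) × (Fin m → H) => (q.1 k, q.2 k))
        (by fun_prop)
  symm x y := by
    simp_rw [corrKernel_eq_prod N hm, fun k => indic_seminorm_sub_comm N ε (x k) (y k)]

theorem measurable_ballMass {N : Seminorm 𝕜 H} (hN : Measurable N) (μ : Measure H)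
    [IsProbabilityMeasure μ] (ε : ℝ) : Measurable (ballMass N μ ε) :=
  ((measurable_indic_sub hN ε).comp measurable_swap).stronglyMeasurable.integral_prod_right
    (f := fun (y x : H) => indic ε (N (x - y))) |>.measurable

theorem measurable_prod_ballMass {N : Seminorm 𝕜 H} (hN : Measurable N) (μ : Measure H)
    [IsProbabilityMeasure μ] (m : ℕ) (ε : ℝ) :
    Measurable fun y : Fin m → H => ∏ k, ballMass N μ ε (y k) :=
  Finset.measurable_fun_prod _ fun k _ => (measurable_ballMass hN μ ε).comp (measurable_pi_apply k)

theorem degenerateKernel_symm {N : Seminorm 𝕜 H} (hN : Measurable N) (μ : Measure H)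
    {m : ℕ} (hm : 1 ≤ m) (ε : ℝ) (x y : Fin m → H) :
    degenerateKernel N μ m ε x y = degenerateKernel N μ m ε y x := by
  rw [degenerateKernel, degenerateKernel, (isKernelTwo_corrKernel hN hm ε).symm x y]
  ring

theorem measurable_degenerateKernel {N : Seminorm 𝕜 H} (hN : Measurable N) (μ : Measure H)
    [IsProbabilityMeasure μ] {m : ℕ} (hm : 1 ≤ m) (ε : ℝ) :
    Measurable fun q : (Fin m → H) × (Fin m → H) => degenerateKernel N μ m ε q.1 q.2 :=
  (((isKernelTwo_corrKernel hN hm ε).measurable.sub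
    ((measurable_prod_ballMass hN μ m ε).comp measurable_fst)).sub
      ((measurable_prod_ballMass hN μ m ε).comp measurable_snd)).add_const _

/-- The kernel integrates to the projection at `y`, and the projection at `x` integrates to `C ^ m`;
the four terms cancel in pairs. -/
theorem integral_degenerateKernel {N : Seminorm 𝕜 H} (hN : Measurable N) (μ : Measure H)
    [IsProbabilityMeasure μ] {m : ℕ} (hm : 1 ≤ m) (ε : ℝ) (y : Fin m → H) :
    ∫ x, degenerateKernel N μ m ε x y ∂(Measure.pi fun _ => μ) = 0 := by
  have h1 : Integrable (fun x => corrKernel (N : H → ℝ) m ε x y) (Measure.pi fun _ => μ) :=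
    Integrable.of_bound ((isKernelTwo_corrKernel hN hm ε).measurable.comp
      (f := fun x => (x, y)) (by fun_prop)).aestronglyMeasurable 1
      (ae_of_all _ fun x => abs_corrKernel_le N m ε x y)
  have h2 : Integrable (fun x : Fin m → H => ∏ k, ballMass N μ ε (x k)) (Measure.pi fun _ => μ) :=
    Integrable.of_bound (measurable_prod_ballMass hN μ m ε).aestronglyMeasurable 1
      (ae_of_all _ fun x => abs_prod_ballMass_le N μ ε x)
  have h12 : Integrable (fun x : Fin m → H => corrKernel (N : H → ℝ) m ε x y
      - ∏ k, ballMass N μ ε (x k)) (Measure.pi fun _ => μ) := h1.sub h2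
  have h123 : Integrable (fun x : Fin m → H => corrKernel (N : H → ℝ) m ε x y
      - ∏ k, ballMass N μ ε (x k) - ∏ k, ballMass N μ ε (y k)) (Measure.pi fun _ => μ) :=
    h12.sub (integrable_const _)
  simp only [degenerateKernel]
  rw [integral_add h123 (integrable_const _), integral_sub h12 (integrable_const _),
    integral_sub h1 h2, integral_corrKernel N μ hm, integral_prod_ballMass]
  simp

end

/-! ### Hoeffding decomposition of sums over pairs; positivity of the variance -/

/-- Summing over the pairs `1 ≤ s < t ≤ n` a sum of functions of the single indices. -/
theorem sum_pairs_add (φ : ℤ → ℝ) (n : ℕ) :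
    ∑ s ∈ Finset.Icc (1 : ℤ) n, ∑ t ∈ Finset.Ioc s (n : ℤ), (φ s + φ t)
      = ((n : ℝ) - 1) * ∑ s ∈ Finset.Icc (1 : ℤ) n, φ s := by
  -- An index is the smaller member of `n - s` pairs and the larger member of `s - 1`, hence belongs
  -- to `n - 1` in all.
  have h1 : ∑ s ∈ Finset.Icc (1 : ℤ) n, ∑ t ∈ Finset.Ioc s (n : ℤ), φ s
      = ∑ s ∈ Finset.Icc (1 : ℤ) n, ((n : ℝ) - s) * φ s := by
    refine Finset.sum_congr rfl fun s hs => ?_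
    rw [Finset.mem_Icc] at hs
    rw [Finset.sum_const, nsmul_eq_mul, Int.card_Ioc]
    congr 1
    have : (((n : ℤ) - s).toNat : ℤ) = n - s := Int.toNat_of_nonneg (by omega)
    exact_mod_cast congrArg (Int.cast : ℤ → ℝ) this
  have h2 : ∑ s ∈ Finset.Icc (1 : ℤ) n, ∑ t ∈ Finset.Ioc s (n : ℤ), φ t
      = ∑ t ∈ Finset.Icc (1 : ℤ) n, ((t : ℝ) - 1) * φ t := by
    rw [Finset.sum_comm' (t' := Finset.Icc (1 : ℤ) n) (s' := fun t => Finset.Ico 1 t)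
      (fun s t => by simp only [Finset.mem_Icc, Finset.mem_Ioc, Finset.mem_Ico]; omega)]
    refine Finset.sum_congr rfl fun t ht => ?_
    rw [Finset.mem_Icc] at ht
    rw [Finset.sum_const, nsmul_eq_mul, Int.card_Ico]
    congr 1
    have : ((t - 1).toNat : ℤ) = t - 1 := Int.toNat_of_nonneg (by omega)
    exact_mod_cast congrArg (Int.cast : ℤ → ℝ) this
  simp only [Finset.sum_add_distrib]
  rw [h1, h2, ← Finset.sum_add_distrib, Finset.mul_sum]
  exact Finset.sum_congr rfl fun s _ => by ring

theorem sum_Icc_one_eq_sum_range (φ : ℤ → ℝ) (n : ℕ) :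
    ∑ s ∈ Finset.Icc (1 : ℤ) n, φ s = ∑ t ∈ Finset.range n, φ (t + 1) := by
  induction n with
  | zero => simp
  | succ n ih =>
    rw [Finset.sum_range_succ, ← ih]
    have : Finset.Icc (1 : ℤ) ((n + 1 : ℕ) : ℤ) = insert ((n : ℤ) + 1) (Finset.Icc (1 : ℤ) n) := by
      ext t; simp only [Finset.mem_Icc, Finset.mem_insert]; push_cast; omega
    rw [this, Finset.sum_insert (by simp), add_comm]

/-- The Hoeffding decomposition of a sum over pairs, in terms of numerical arrays. -/
theorem sum_pairs_hoeffding {h f : ℤ → ℤ → ℝ} {g : ℤ → ℝ} {θ : ℝ}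
    (hf : ∀ s t, f s t = h s t - g s - g t + θ) (n : ℕ) :
    ∑ s ∈ Finset.Icc (1 : ℤ) n, ∑ t ∈ Finset.Ioc s (n : ℤ), h s t
      = ∑ s ∈ Finset.Icc (1 : ℤ) n, ∑ t ∈ Finset.Ioc s (n : ℤ), f s t
        + (n - 1) * ∑ s ∈ Finset.Icc (1 : ℤ) n, (g s - θ) + (n - 1) * n / 2 * θ := by
  -- Splitting `θ` evenly gives the form `φ s + φ t` required by `sum_pairs_add`.
  have h1 : ∀ s t, h s t = f s t + ((g s - θ / 2) + (g t - θ / 2)) := fun s t => by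
    rw [hf]; ring
  have h2 : ∀ s, ∑ t ∈ Finset.Ioc s (n : ℤ), h s t = ∑ t ∈ Finset.Ioc s (n : ℤ), f s t
      + ∑ t ∈ Finset.Ioc s (n : ℤ), ((g s - θ / 2) + (g t - θ / 2)) := fun s => by
    rw [← Finset.sum_add_distrib]
    exact Finset.sum_congr rfl fun t _ => h1 s t
  rw [Finset.sum_congr rfl fun s _ => h2 s, Finset.sum_add_distrib,
    sum_pairs_add fun s => g s - θ / 2]
  simp only [Finset.sum_sub_distrib, Finset.sum_const, Int.card_Icc, nsmul_eq_mul]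
  simp
  ring

/-- Lag `0` contributes `K^m - C^(2m) > 0`, and the other covariances are nonnegative because `C² ≤
K`. -/
theorem longRunVar_pos {K C : ℝ} {m : ℕ} (hm : 1 ≤ m) (h : C ^ 2 < K) : 0 < longRunVar K C m := by
  have hC : 0 ≤ C ^ 2 := sq_nonneg C
  have h0 : 0 < windowCov K C m 0 := by
    have := pow_lt_pow_left₀ h hC (n := m) (by omega)
    simpa [windowCov, pow_mul] using this
  refine add_pos_of_pos_of_nonneg h0 (mul_nonneg zero_le_two (Finset.sum_nonneg fun i hi => ?_))
  rw [Finset.mem_Ico] at hi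
  rw [windowCov, min_eq_left hi.2.le, sub_nonneg, pow_mul, pow_mul]
  calc (C ^ 2) ^ m = (C ^ 2) ^ (m - i) * (C ^ 2) ^ i := by rw [← pow_add]; congr 1; omega
    _ ≤ _ := by gcongr

theorem sq_div_four_le_choose_two {n : ℕ} (hn : 2 ≤ n) : (n : ℝ) ^ 2 / 4 ≤ (n.choose 2 : ℕ) := by
  rw [Nat.cast_choose_two]
  have : (2 : ℝ) ≤ n := by exact_mod_cast hn
  nlinarith

theorem map_history {Ω H : Type*} [MeasurableSpace Ω] [MeasurableSpace H] {P : Measure Ω}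
    {X : ℤ → Ω → H} (hX : ∀ t, Measurable (X t)) (hind : iIndepFun X P)
    (hid : ∀ t, IdentDistrib (X t) (X 0) P P) (m : ℕ) (t : ℤ) :
    P.map (history X m t) = Measure.pi fun _ => P.map (X 0) := by
  have hinj : Function.Injective fun k : Fin m => t + ((k : ℕ) : ℤ) :=
    fun k l hkl => by ext; simpa using hkl
  have := (hind.precomp hinj).map_fun_eq_pi_map fun k => (hX _).aemeasurable
  exact this.trans (congrArg Measure.pi (funext fun k => (hid _).map_eq))

/-! ### The correlation integral: diagonal terms, decomposition and limit -/

section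

variable {𝕜 H Ω : Type*} [RCLike 𝕜] [NormedAddCommGroup H] [InnerProductSpace 𝕜 H]

theorem corrIntegral_eq_uStatTwo (N : Seminorm 𝕜 H) (X : ℤ → Ω → H) (m n : ℕ) (ε : ℝ) (ω : Ω) :
    corrIntegral N X m n ε ω = uStatTwo (corrKernel N m ε) (history X m) n ω :=
  rfl

theorem corrIntegralDiag_eq (N : Seminorm 𝕜 H) (X : ℤ → Ω → H) {m : ℕ} (hm : 1 ≤ m) (n : ℕ)
    {ε : ℝ} (hε : 0 < ε) (ω : Ω) :
    corrIntegralDiag N X m n ε ω = corrIntegral N X m n ε ω + ((n.choose 2 : ℕ) : ℝ)⁻¹ * n := by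
  have h1 : ∀ s ∈ Finset.Icc (1 : ℤ) n, ∑ t ∈ Finset.Icc s (n : ℤ),
      indic ε (maxNorm N (history X m s ω - history X m t ω))
      = ∑ t ∈ Finset.Ioc s (n : ℤ), indic ε (maxNorm N (history X m s ω - history X m t ω))
        + 1 := by
    intro s hs
    rw [Finset.mem_Icc] at hs
    rw [← Finset.Ioc_insert_left hs.2, Finset.sum_insert (by simp), add_comm]
    congr 1
    exact corrKernel_self N hm hε _
  rw [corrIntegralDiag, corrIntegral, Finset.sum_congr rfl h1, Finset.sum_add_distrib, mul_add]
  simp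

/-- Including the diagonal does not change the limit distribution. -/
theorem tendstoInDistribution_corrIntegralDiag [MeasurableSpace Ω] {P : Measure Ω}
    [IsProbabilityMeasure P] {N : Seminorm 𝕜 H} {X : ℤ → Ω → H}
    {m : ℕ} (hm : 1 ≤ m) {ε : ℝ} (hε : 0 < ε) {c σ : ℝ}
    (h : TendstoInDistribution (fun (n : ℕ) ω => √n * ((corrIntegral N X m n ε ω - c) / σ))
      atTop id (fun _ => P) (gaussianReal 0 1)) :
    TendstoInDistribution (fun (n : ℕ) ω => √n * ((corrIntegralDiag N X m n ε ω - c) / σ))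
      atTop id (fun _ => P) (gaussianReal 0 1) := by
  -- The `n` diagonal terms all equal `1`; since `n.choose 2 ≥ n² / 4`, their scaled contribution is
  -- at most `4 / √n`.
  have hlim : Tendsto (fun n : ℕ => √(n : ℝ) * (((n.choose 2 : ℕ) : ℝ)⁻¹ * n)) atTop (𝓝 0) := by
    have h4 : Tendsto (fun n : ℕ => 4 / √(n : ℝ)) atTop (𝓝 0) :=
      tendsto_const_nhds.div_atTop (Real.tendsto_sqrt_atTop.comp tendsto_natCast_atTop_atTop)
    refine squeeze_zero' (Eventually.of_forall fun n => by positivity) ?_ h4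
    filter_upwards [eventually_ge_atTop 2] with n hn
    have hn0 : (0 : ℝ) < n := by exact_mod_cast (by omega : 0 < n)
    have hsq : √(n : ℝ) ^ 2 = n := Real.sq_sqrt hn0.le
    have hs0 : 0 < √(n : ℝ) := by positivity
    calc _ ≤ √(n : ℝ) * (((n : ℝ) ^ 2 / 4)⁻¹ * n) := by
          gcongr
          exact sq_div_four_le_choose_two hn
      _ = 4 / √(n : ℝ) := by
          field_simp
          exact hsq
  have hlim' : Tendsto (fun n : ℕ => √(n : ℝ) * (((n.choose 2 : ℕ) : ℝ)⁻¹ * n) / σ) atTop (𝓝 0) := by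
    simpa using hlim.div_const σ
  have heq : ∀ (n : ℕ) ω, √n * ((corrIntegralDiag N X m n ε ω - c) / σ)
      = √n * ((corrIntegral N X m n ε ω - c) / σ)
        + √(n : ℝ) * (((n.choose 2 : ℕ) : ℝ)⁻¹ * n) / σ := fun n ω => by
    rw [corrIntegralDiag_eq N X hm n hε]
    ring
  simp_rw [heq]
  have h0 := h.add_of_tendstoInMeasure_const
    (Y := fun (n : ℕ) _ => √(n : ℝ) * (((n.choose 2 : ℕ) : ℝ)⁻¹ * n) / σ) (c := 0)
    (tendstoInMeasure_of_tendsto_ae (fun n => aestronglyMeasurable_const)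
      (ae_of_all _ fun _ => hlim')) (fun n => aemeasurable_const)
  exact h0.congr (fun n => ae_of_all _ fun _ => rfl) (ae_of_all _ fun x => by simp)

variable [MeasurableSpace H]

/-- Histories are summed from time `1` and windows from `0`, whence the shift to `X (j + 1)`. -/
theorem prod_ballMass_history_sub (N : Seminorm 𝕜 H) (μ : Measure H) (X : ℤ → Ω → H) (C ε : ℝ)
    (m t : ℕ) (ω : Ω) :
    ∏ k, ballMass N μ ε (history X m (t + 1) ω k) - C ^ m
      = windowProd (fun (j : ℕ) ω => ballMass N μ ε (X (j + 1) ω)) C m t ω := by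
  rw [windowProd, Finset.prod_Ico_eq_prod_range, Nat.add_sub_cancel_left, Finset.prod_range]
  congr 1
  refine Finset.prod_congr rfl fun k _ => ?_
  rw [history]
  congr 2
  push_cast
  ring

/-- The sum of the degenerate kernel over the pairs of histories. -/
noncomputable def degenerateSum (N : Seminorm 𝕜 H) (μ : Measure H) (X : ℤ → Ω → H) (m : ℕ)
    (ε : ℝ) (n : ℕ) (ω : Ω) : ℝ :=
  ∑ s ∈ Finset.Icc (1 : ℤ) n, ∑ t ∈ Finset.Ioc s (n : ℤ),
    degenerateKernel N μ m ε (history X m s ω) (history X m t ω)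

/-- The Hoeffding decomposition of the correlation integral. -/
theorem corrIntegral_sub_eq (N : Seminorm 𝕜 H) (μ : Measure H) (X : ℤ → Ω → H) (m : ℕ) (ε : ℝ)
    {n : ℕ} (hn : 2 ≤ n) (ω : Ω) :
    corrIntegral N X m n ε ω - corrC N μ ε ^ m
      = ((n.choose 2 : ℕ) : ℝ)⁻¹ * degenerateSum N μ X m ε n ω
        + 2 * (n : ℝ)⁻¹ * ∑ t ∈ Finset.range n,
          windowProd (fun (j : ℕ) ω => ballMass N μ ε (X (j + 1) ω)) (corrC N μ ε) m t ω := by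
  have h := sum_pairs_hoeffding
    (h := fun s t => corrKernel N m ε (history X m s ω) (history X m t ω))
    (f := fun s t => degenerateKernel N μ m ε (history X m s ω) (history X m t ω))
    (g := fun s => ∏ k, ballMass N μ ε (history X m s ω k)) (θ := corrC N μ ε ^ m)
    (fun s t => rfl) n
  rw [sum_Icc_one_eq_sum_range
    (fun s => ∏ k, ballMass N μ ε (history X m s ω k) - corrC N μ ε ^ m)] at h
  simp_rw [prod_ballMass_history_sub] at h
  -- The coefficient of the linear part is `(n - 1) / n.choose 2 = 2 / n`.
  rw [corrIntegral_eq_uStatTwo, uStatTwo, h, Nat.cast_choose_two, degenerateSum]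
  have h1 : (2 : ℝ) ≤ n := by exact_mod_cast hn
  have h2 : (n : ℝ) - 1 ≠ 0 := by linarith
  have h3 : (n : ℝ) ≠ 0 := by linarith
  field_simp
  ring

variable [TopologicalSpace.SeparableSpace H] [BorelSpace H]
  [MeasurableSpace Ω] {P : Measure Ω} [IsProbabilityMeasure P] {N : Seminorm 𝕜 H}
  {X : ℤ → Ω → H}

theorem isBoundedIID_ballMass (hN : Measurable N) (hX : ∀ t, Measurable (X t))
    (hind : iIndepFun X P) (hid : ∀ t, IdentDistrib (X t) (X 0) P P) (ε : ℝ) :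
    IsBoundedIID P (fun (j : ℕ) ω => ballMass N (P.map (X 0)) ε (X (j + 1) ω))
      (corrC N (P.map (X 0)) ε) (corrK N (P.map (X 0)) ε) := by
  have : IsProbabilityMeasure (P.map (X 0)) :=
    Measure.isProbabilityMeasure_map (hX 0).aemeasurable
  have hb := measurable_ballMass hN (P.map (X 0)) ε
  have h0 : ∀ {u : H → ℝ}, Measurable u →
      ∫ ω, u (X ((0 : ℕ) + 1) ω) ∂P = ∫ y, u y ∂(P.map (X 0)) := fun {u} hu => by
    rw [← (hid ((0 : ℕ) + 1)).map_eq, integral_map (hX _).aemeasurable hu.aestronglyMeasurable]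
  refine ⟨fun j => hb.comp (hX _), fun j ω => abs_ballMass_le N _ ε _, ?_, fun j => ?_, h0 hb,
    h0 (hb.pow_const 2)⟩
  · exact (hind.precomp (g := fun j : ℕ => (j : ℤ) + 1) (fun a b hab => by simpa using hab)).comp
      (fun _ => ballMass N (P.map (X 0)) ε) fun _ => hb
  · exact ((hid _).trans (hid _).symm).comp hb

/-- The constant is `768 = 4² * 3 * 4²`, from the kernel bound `4`, the three matchings and `(4 * m)
^ 2`. -/
theorem integral_degenerateSum_sq_le (hN : Measurable N) (hX : ∀ t, Measurable (X t))
    (hind : iIndepFun X P) (hid : ∀ t, IdentDistrib (X t) (X 0) P P) {m : ℕ} (hm : 1 ≤ m)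
    (ε : ℝ) (n : ℕ) :
    ∫ ω, degenerateSum N (P.map (X 0)) X m ε n ω ^ 2 ∂P ≤ 768 * m ^ 2 * (n : ℝ) ^ 2 := by
  have : IsProbabilityMeasure (P.map (X 0)) :=
    Measure.isProbabilityMeasure_map (hX 0).aemeasurable
  set μ := P.map (X 0)
  let Q := (Finset.Icc (1 : ℤ) n ×ˢ Finset.Icc (1 : ℤ) n).filter fun q => q.1 < q.2
  have h1 : ∀ ω, degenerateSum N μ X m ε n ω
      = ∑ q ∈ Q, degenerateKernel N μ m ε (history X m q.1 ω) (history X m q.2 ω) := fun ω => by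
    simp only [Q, degenerateSum]
    rw [Finset.sum_filter, Finset.sum_product]
    refine Finset.sum_congr rfl fun s hs => ?_
    rw [← Finset.sum_filter]
    refine Finset.sum_congr ?_ fun _ _ => rfl
    ext t
    simp only [Finset.mem_Icc, Finset.mem_Ioc, Finset.mem_filter] at hs ⊢
    omega
  simp_rw [h1]
  have h := integral_sum_degenerate_sq_le (P := P) (Y := history X m) (m := m)
    (ν := Measure.pi fun _ => μ) (B := 4)
    (fun t => measurable_pi_lambda _ fun k => hX _) (map_history hX hind hid m)
    (measurable_degenerateKernel hN μ hm ε) (degenerateKernel_symm hN μ hm ε)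
    (abs_degenerateKernel_le N μ ε) (integral_degenerateKernel hN μ hm ε)
    (fun a b c d => indepFun_history hX hind m) (Finset.Icc (1 : ℤ) n) (Q := Q)
    (Finset.filter_subset _ _)
  refine h.trans (le_of_eq ?_)
  rw [Int.card_Icc]
  simp
  ring

theorem memLp_corrIntegral (hN : Measurable N) (hX : ∀ t, Measurable (X t)) {m : ℕ} (hm : 1 ≤ m)
    (n : ℕ) (ε : ℝ) : MemLp (corrIntegral N X m n ε) 2 P := by
  have hY : ∀ t, Measurable (history X m t) := fun t => measurable_pi_lambda _ fun k => hX _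
  have h : ∀ s t, MemLp
      (fun ω => corrKernel (N : H → ℝ) m ε (history X m s ω) (history X m t ω)) 2 P := fun s t =>
    MemLp.of_bound ((isKernelTwo_corrKernel hN hm ε).measurable.comp
      ((hY s).prodMk (hY t))).aestronglyMeasurable 1
      (ae_of_all _ fun ω => abs_corrKernel_le N m ε (history X m s ω) (history X m t ω))
  have hsum := (memLp_finsetSum (Finset.Icc (1 : ℤ) n) fun s _ =>
    memLp_finsetSum (Finset.Ioc s (n : ℤ)) fun t _ => h s t).const_mul ((n.choose 2 : ℕ) : ℝ)⁻¹
  exact hsum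

/-- Asymptotic normality of the functional correlation integral. -/
theorem tendstoInDistribution_corrIntegral (hN : Measurable N) (hX : ∀ t, Measurable (X t))
    (hind : iIndepFun X P) (hid : ∀ t, IdentDistrib (X t) (X 0) P P) {m : ℕ} (hm : 1 ≤ m)
    (ε : ℝ) (hKC : corrC N (P.map (X 0)) ε ^ 2 < corrK N (P.map (X 0)) ε) :
    TendstoInDistribution (fun (n : ℕ) ω => √n *
        ((corrIntegral N X m n ε ω - corrC N (P.map (X 0)) ε ^ m)
          / √(sigmaSq (corrK N (P.map (X 0)) ε) (corrC N (P.map (X 0)) ε) m)))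
      atTop id (fun _ => P) (gaussianReal 0 1) := by
  have hiid := isBoundedIID_ballMass hN hX hind hid ε
  have hτ := longRunVar_pos hm hKC
  set μ := P.map (X 0)
  set C := corrC N μ ε
  set K := corrK N μ ε
  set τ := longRunVar K C m
  rw [sigmaSq_eq]
  set σ := √(4 * τ)
  have hσ : 0 < σ := Real.sqrt_pos.2 (by positivity)
  have hσ2 : σ ^ 2 = 4 * τ := Real.sq_sqrt (by positivity)
  set W : ℕ → Ω → ℝ := fun n ω => ∑ t ∈ Finset.range n,
    windowProd (fun (j : ℕ) ω => ballMass N μ ε (X (j + 1) ω)) C m t ω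
  -- Scaling by `2 / σ` turns the variance `τ` into `4 * τ / σ ^ 2 = 1`.
  have hclt := (hiid.tendstoInDistribution_sum_windowProd hm).continuous_comp
    (g := fun x : ℝ => 2 / σ * x) (by fun_prop)
  have hmap : (gaussianReal 0 τ.toNNReal).map ((fun x : ℝ => 2 / σ * x) ∘ id)
      = gaussianReal 0 1 := by
    rw [Function.comp_id, gaussianReal_map_const_mul]
    congr 1
    · simp
    · ext
      simp only [NNReal.coe_mul, NNReal.coe_mk, Real.coe_toNNReal _ hτ.le, NNReal.coe_one]
      rw [div_pow, hσ2]
      field_simp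
      norm_num
  have hlin : TendstoInDistribution (fun (n : ℕ) ω => 2 / σ * ((√n)⁻¹ * W n ω))
      atTop id (fun _ => P) (gaussianReal 0 1) :=
    TendstoInDistribution.id_of_map_eq hclt hmap
  have hW : ∀ n, MemLp (W n) 2 P := fun n => hiid.memLp_sum_windowProd m _
  have hT : ∀ n : ℕ, MemLp (fun ω => √n * ((corrIntegral N X m n ε ω - C ^ m) / σ)) 2 P := by
    intro n
    simp_rw [div_eq_mul_inv]
    exact (((memLp_corrIntegral hN hX hm n ε).sub (memLp_const _)).mul_const _).const_mul _
  have hD : ∀ n : ℕ, MemLp (fun ω => √n * ((corrIntegral N X m n ε ω - C ^ m) / σ)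
      - 2 / σ * ((√n)⁻¹ * W n ω)) 2 P := fun n =>
    (hT n).sub (((hW n).const_mul _).const_mul _)
  refine tendstoInDistribution_of_tendstoInMeasure_sub _ _ hlin ?_
    (fun n => (hT n).aestronglyMeasurable.aemeasurable)
  refine tendstoInMeasure_zero_of_integral_sq hD ?_
  -- What is left is the scaled degenerate sum: `n / σ² * (4 / n²)² * 768 m² n²` equals `12288 m² /
  -- (σ² n)`.
  refine squeeze_zero' (g := fun n : ℕ => 12288 * m ^ 2 / σ ^ 2 / (n : ℝ))
    (Eventually.of_forall fun n => integral_nonneg fun ω => sq_nonneg _) ?_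
    (tendsto_const_div_atTop_nhds_zero_nat _)
  filter_upwards [eventually_ge_atTop 2] with n hn
  have hn0 : (0 : ℝ) < n := by exact_mod_cast (by omega : 0 < n)
  have hsq : √(n : ℝ) ^ 2 = n := Real.sq_sqrt hn0.le
  have hs0 : √(n : ℝ) ≠ 0 := by positivity
  have heq : ∀ ω, √n * ((corrIntegral N X m n ε ω - C ^ m) / σ) - 2 / σ * ((√n)⁻¹ * W n ω)
      = √n / σ * ((n.choose 2 : ℕ) : ℝ)⁻¹ * degenerateSum N μ X m ε n ω := fun ω => by
    rw [corrIntegral_sub_eq N μ X m ε hn ω]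
    have : (n : ℝ)⁻¹ = (√(n : ℝ))⁻¹ * (√(n : ℝ))⁻¹ := by rw [← mul_inv, ← sq, hsq]
    rw [this]
    simp only [W]
    field_simp
    ring
  simp only [Pi.sub_apply]
  simp_rw [heq, mul_pow]
  rw [integral_const_mul, div_pow, hsq]
  have hch := sq_div_four_le_choose_two hn
  have hch' : (((n.choose 2 : ℕ) : ℝ)⁻¹) ^ 2 ≤ (((n : ℝ) ^ 2 / 4)⁻¹) ^ 2 := by
    gcongr
  calc _ ≤ (n : ℝ) / σ ^ 2 * (((n : ℝ) ^ 2 / 4)⁻¹) ^ 2 * (768 * m ^ 2 * (n : ℝ) ^ 2) := by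
        gcongr
        exact integral_degenerateSum_sq_le hN hX hind hid hm ε n
    _ = _ := by
        field_simp
        norm_num

end

end FunctionalBDS

theorem theorem1
    {𝕜 H Ω : Type*} [RCLike 𝕜]
    [NormedAddCommGroup H] [InnerProductSpace 𝕜 H] [CompleteSpace H]
    [TopologicalSpace.SeparableSpace H] [MeasurableSpace H] [BorelSpace H]
    [MeasurableSpace Ω] (P : Measure Ω) [IsProbabilityMeasure P]
    -- the norm used for distances: any Borel measurable norm, e.g. the Hilbert norm
    (N : Seminorm 𝕜 H) (hN_def : ∀ x, N x = 0 → x = 0) (hN_meas : Measurable N)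
    (X : ℤ → Ω → H) (hX_meas : ∀ t, Measurable (X t))
    (hX_indep : iIndepFun X P) (hX_ident : ∀ t, IdentDistrib (X t) (X 0) P P)
    (m : ℕ) (hm : 1 ≤ m) (ε : ℝ) (hε : 0 < ε)
    (hKC : FunctionalBDS.corrC N (P.map (X 0)) ε ^ 2 < FunctionalBDS.corrK N (P.map (X 0)) ε) :
    let C := FunctionalBDS.corrC N (P.map (X 0)) ε
    let K := FunctionalBDS.corrK N (P.map (X 0)) ε
    let σ := Real.sqrt (FunctionalBDS.sigmaSq K C m)
    FunctionalBDS.IsKernelTwo (FunctionalBDS.corrKernel (N : H → ℝ) m ε) ∧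
    (∀ n ω, FunctionalBDS.corrIntegral N X m n ε ω =
      FunctionalBDS.uStatTwo (FunctionalBDS.corrKernel N m ε) (FunctionalBDS.history X m) n ω) ∧
    0 < FunctionalBDS.sigmaSq K C m ∧
    TendstoInDistribution
      (fun (n : ℕ) ω => Real.sqrt n * ((FunctionalBDS.corrIntegral N X m n ε ω - C ^ m) / σ))
      atTop id (fun _ => P) (gaussianReal 0 1) ∧
    TendstoInDistribution
      (fun (n : ℕ) ω => Real.sqrt n * ((FunctionalBDS.corrIntegralDiag N X m n ε ω - C ^ m) / σ))
      atTop id (fun _ => P) (gaussianReal 0 1) := by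
  intro C K σ
  have hclt := FunctionalBDS.tendstoInDistribution_corrIntegral hN_meas hX_meas hX_indep hX_ident
    hm ε hKC
  refine ⟨FunctionalBDS.isKernelTwo_corrKernel hN_meas hm ε,
    fun n ω => FunctionalBDS.corrIntegral_eq_uStatTwo N X m n ε ω, ?_, hclt,
    FunctionalBDS.tendstoInDistribution_corrIntegralDiag hm hε hclt⟩
  rw [FunctionalBDS.sigmaSq_eq]
  exact mul_pos (by norm_num) (FunctionalBDS.longRunVar_pos hm hKC)
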